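/- Let $W$ be a standard one-dimensional Brownian motion on a probability space $(\Omega,\mathcal F,\mathbb P)$, let $H\in(0,1)$, $\zeta:=H-\tfrac12$, and let $X$ be the continuous version of the Riemann–Liouville (type-II) fractional Brownian motion $$X_t=\sqrt{2\zeta+1}\int_0^t (t-s)^{\zeta}\,\mathrm dW_s,\qquad t\ge 0 .$$ Let $T>0$ and let $\pi^n=\{0=t^n_0<t^n_1<\dots<t^n_{N(n)}=T\}$, $n\in\mathbb N$, be a sequence of partitions of $[0,T]$ into $N(n)\ge 1$ intervals of equal length $\Delta(n)=T/N(n)$, such that $\Delta(n)\to 0$ as $n\to\infty$. Writing $t_k=t_k^n=k\Delta(n)$, define the hybrid scheme (with truncation level $\kappa=1$) along $\pi^n$ by $\mathcal G X^n_0:=0$ and, for $k=1,\dots,N(n)$, $$\mathcal G X^n_{t_k}:=\sqrt{2\zeta+1}\int_{t_{k-1}}^{t_k}(t_k-s)^{\zeta}\,\mathrm dW_s+\sqrt{2\zeta+1}\sum_{i=2}^{k} b^*_i\,\big(W_{t_{k-i+1}}-W_{t_{k-i}}\big),\qquad b_i^*:=\frac1{\Delta(n)}\int_{t_{i-1}}^{t_i}s^{\zeta}\,\mathrm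 ds,$$ extended to a continuous process on $[0,T]$ by piecewise linear interpolation between the partition points. For $\gamma\in(0,1)$ and $f:[0,T]\to\mathbb R$ let $$|f|_{C^\gamma[0,T]}:=\sup_{t\in[0,T]}|f(t)|+\sup_{0\le s<t\le T}\frac{|f(t)-f(s)|}{(t-s)^\gamma}.$$ Then, for every $\gamma\in(0,H)$, $$\lim_{n\to\infty}\big|\mathcal G X^n-X\big|_{C^\gamma[0,T]}=0$$ almost surely and in $L^p(\Omega)$ for every $p\in[1,\infty)$ (in particular, $|\mathcal G X^n-X|_{C^\gamma[0,T]}\in L^p(\Omega)$ for every $n$). -/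

import Mathlib

open MeasureTheory ProbabilityTheory Filter Topology
open scoped NNReal ENNReal

noncomputable section

namespace HybridScheme

variable {Ω : Type*} [MeasurableSpace Ω]

/-- The step function `s ↦ ∑ c_t 1_{[0,t]}(s)` on `[0,∞)` with coefficients `c`
(finitely many nonzero); note `1_{(a,b]} = 1_{[0,b]} - 1_{[0,a]}`. -/
def stepFun (c : ℝ≥0 →₀ ℝ) (s : ℝ) : ℝ :=
  c.sum fun t x => x * (Set.Icc (0 : ℝ) t).indicator (fun _ => 1) s

/-- The elementary stochastic integral `∑ c_t W_t` of the step function `stepFun c`; in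
particular `1_{(a,b]}` is sent to `W_b - W_a`. -/
def stepIntegral (W : ℝ≥0 → Ω → ℝ) (c : ℝ≥0 →₀ ℝ) (ω : Ω) : ℝ :=
  c.sum fun t x => x * W t ω

/-- `I` is (a version of) the Wiener integral `∫_0^∞ f(s) dW_s` of the deterministic function
`f ∈ L²([0,∞))`: the `L²(P)`-limit of the elementary integrals of step functions that converge
to `f` in `L²([0,∞))`. -/
def IsWienerIntegral (W : ℝ≥0 → Ω → ℝ) (P : Measure Ω) (f : ℝ → ℝ) (I : Ω → ℝ) : Prop :=
  MemLp f 2 (volume.restrict (Set.Ici (0 : ℝ))) ∧ MemLp I 2 P ∧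
    ∃ c : ℕ → ℝ≥0 →₀ ℝ,
      Tendsto (fun n => eLpNorm (fun s => stepFun (c n) s - f s) 2
        (volume.restrict (Set.Ici (0 : ℝ)))) atTop (𝓝 0) ∧
      Tendsto (fun n => eLpNorm (fun ω => stepIntegral W (c n) ω - I ω) 2 P) atTop (𝓝 0)

open Classical in
/-- The Wiener integral `∫_0^∞ f(s) dW_s` (some version of it; it is unique up to null sets). -/
def wienerIntegral (W : ℝ≥0 → Ω → ℝ) (P : Measure Ω) (f : ℝ → ℝ) : Ω → ℝ :=
  if h : ∃ I, IsWienerIntegral W P f I then h.choose else 0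

/-- The function `s ↦ (t - s)^ζ 1_{(a,t]}(s)`. -/
def powerKernel (ζ : ℝ) (a t : ℝ≥0) : ℝ → ℝ :=
  (Set.Ioc (a : ℝ) t).indicator fun s => ((t : ℝ) - s) ^ ζ

/-- `X` is the (continuous version of the) Riemann–Liouville, or type-II, fractional Brownian
motion `X_t = √(2ζ+1) ∫_0^t (t-s)^ζ dW_s`, `ζ = H - 1/2`, driven by `W`. -/
structure IsRiemannLiouvilleFBM (H : ℝ) (W : ℝ≥0 → Ω → ℝ) (P : Measure Ω)
    (X : ℝ≥0 → Ω → ℝ) : Prop where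
  ae_eq_integral : ∀ t : ℝ≥0, X t =ᵐ[P] fun ω =>
    √(2 * (H - 1 / 2) + 1) * wienerIntegral W P (powerKernel (H - 1 / 2) 0 t) ω
  continuous_paths : ∀ᵐ ω ∂P, Continuous fun t => X t ω

/-- The mesh `Δ = T / N` of the uniform partition of `[0,T]` into `N` intervals. -/
def mesh (T : ℝ≥0) (N : ℕ) : ℝ≥0 := T / N

/-- The partition points `t_k = k Δ`. -/
def node (T : ℝ≥0) (N k : ℕ) : ℝ≥0 := k * mesh T N

/-- The weights `b*_i = Δ⁻¹ ∫_{t_{i-1}}^{t_i} s^ζ ds` (used for `i ≥ 2`). -/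
def weight (H : ℝ) (T : ℝ≥0) (N i : ℕ) : ℝ :=
  (mesh T N : ℝ)⁻¹ * ∫ s in (node T N (i - 1) : ℝ)..(node T N i : ℝ), s ^ (H - 1 / 2)

/-- The hybrid scheme with truncation level `κ = 1` at the partition points: `𝒢X_0 = 0` and
`𝒢X_{t_k} = √(2ζ+1) ∫_{t_{k-1}}^{t_k} (t_k-s)^ζ dW_s
  + √(2ζ+1) ∑_{i=2}^k b*_i (W_{t_{k-i+1}} - W_{t_{k-i}})` for `k ≥ 1`. -/
def hybridAtNode (H : ℝ) (T : ℝ≥0) (W : ℝ≥0 → Ω → ℝ) (P : Measure Ω) (N k : ℕ) (ω : Ω) : ℝ :=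
  if k = 0 then 0 else
    √(2 * (H - 1 / 2) + 1) *
        wienerIntegral W P (powerKernel (H - 1 / 2) (node T N (k - 1)) (node T N k)) ω +
      √(2 * (H - 1 / 2) + 1) *
        ∑ i ∈ Finset.Icc 2 k,
          weight H T N i * (W (node T N (k - i + 1)) ω - W (node T N (k - i)) ω)

/-- The hybrid scheme `𝒢X` on `[0,T]`: for `t ∈ [t_k, t_{k+1}]`, the linear interpolation between
the values at `t_k` and `t_{k+1}`. -/
def hybrid (H : ℝ) (T : ℝ≥0) (W : ℝ≥0 → Ω → ℝ) (P : Measure Ω) (N : ℕ) (t : ℝ≥0) (ω : Ω) : ℝ :=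
  let k := ⌊(t / mesh T N : ℝ≥0)⌋₊
  hybridAtNode H T W P N k ω +
    ((t : ℝ) - node T N k) / mesh T N *
      (hybridAtNode H T W P N (k + 1) ω - hybridAtNode H T W P N k ω)

/-- The `C^γ([0,T])`-norm `sup |f| + sup_{s<t} |f t - f s| / (t-s)^γ`, with values in `[0,∞]`. -/
def holderNorm (γ : ℝ) (T : ℝ≥0) (f : ℝ≥0 → ℝ) : ℝ≥0∞ :=
  (⨆ (t : ℝ≥0) (_ : t ≤ T), ENNReal.ofReal |f t|) +
    ⨆ (s : ℝ≥0) (t : ℝ≥0) (_ : s < t) (_ : t ≤ T),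
      ENNReal.ofReal (|f t - f s| / ((t : ℝ) - s) ^ γ)

end HybridScheme

end

noncomputable section

namespace HybridScheme

section

variable {Ω : Type*} [MeasurableSpace Ω]

/-! ### Gaussian moments -/

/-! Write `Δ` for the mesh, `ζ = H - 1/2`, and `E` for the error process (scheme minus `X`). The
proof bounds the moments of the increments of `E`, with a power of `Δ` in front, and feeds them into
Kolmogorov's chaining argument.

Wiener integrals are Gaussian, so their `L^p` norms are at most a constant times the `L²` norm of
the integrand (`IsWienerIntegral.eLpNorm_le`), and only deterministic kernels need estimating. Both
relevant kernel differences are dominated by copies of `domKernel` at some scale `h`, whose `L²`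
norm is of order `h^H`. For the increments of `X` the scale is `t - s`. For the error at a node the
scale is `Δ`: the kernels agree on the cell next to the node, where the singularity sits, and
elsewhere the mean value theorem bounds `v^ζ - b*_i`.

Hence node errors are `O(Δ^H)` in `L^p`, and so are node-to-node increments of the scheme; by linear
interpolation the scheme is Lipschitz in `L^p` with constant `O(Δ^(H-1))`. Using the uniform error
for `t - s ≥ Δ` and the separate increments for `t - s ≤ Δ` gives `‖E_t - E_s‖_p ≤ C Δ^(H-β)
(t-s)^β` for every `β < H` (`lpBound_error_sub`). Chaining over dyadic points with `γ < β` turns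
this into `𝔼 |E|_{C^γ}^p ≤ C Δ^(p(H-β))` for large `p` (`exists_lintegral_errorNorm_rpow_le`).

Convergence in `L^p` is then immediate, small `p` being covered by monotonicity of `L^p` norms under
a probability measure. For almost sure convergence no rate for `Δ(n)` is available, so the moments
are summed over all step numbers `N = 1, 2, …` with `p` so large that they are `O(N⁻²)`. The error
tends to `0` almost surely as `N → ∞`, and the given sequence merely reindexes this limit, because
`N(n) → ∞`. -/

lemma eLpNorm_two_eq_sqrt_integral {α : Type*} [MeasurableSpace α] {μ : Measure α} {f : α → ℝ}
    (hf : MemLp f 2 μ) : eLpNorm f 2 μ = ENNReal.ofReal √(∫ x, f x ^ 2 ∂μ) := by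
  rw [hf.eLpNorm_eq_integral_rpow_norm (by norm_num) (by norm_num), Real.sqrt_eq_rpow]
  simp

/-- The `L^p` norm of a standard Gaussian variable. -/
def gaussianMoment (p : ℝ≥0∞) : ℝ≥0∞ := eLpNorm id p (gaussianReal 0 1)

lemma gaussianMoment_ne_top {p : ℝ≥0∞} (hp : p ≠ ∞) : gaussianMoment p ≠ ∞ :=
  (memLp_id_gaussianReal' p hp).eLpNorm_ne_top

/-- A centred Gaussian of variance `v` has the law of `√v` times a standard one, so all its `L^p`
norms are determined by `v`. -/
lemma eLpNorm_of_hasLaw_gaussianReal {P : Measure Ω} {Y : Ω → ℝ} {v : ℝ≥0}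
    (hY : HasLaw Y (gaussianReal 0 v) P) (p : ℝ≥0∞) :
    eLpNorm Y p P = ENNReal.ofReal √v * gaussianMoment p := by
  have h1 : eLpNorm Y p P = eLpNorm id p (gaussianReal 0 v) := by
    rw [← hY.map_eq, eLpNorm_map_measure aestronglyMeasurable_id hY.aemeasurable]
    rfl
  have h2 : gaussianReal 0 v = (gaussianReal 0 1).map (√v * ·) := by
    rw [gaussianReal_map_const_mul]
    congr 1
    · simp
    · ext
      simp
  rw [h1, h2, eLpNorm_map_measure aestronglyMeasurable_id (by fun_prop)]
  have h3 : (id ∘ fun x : ℝ => √(v : ℝ) * x) = √(v : ℝ) • (id : ℝ → ℝ) := by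
    ext x; simp
  rw [h3, eLpNorm_const_smul, gaussianMoment, Real.enorm_eq_ofReal (Real.sqrt_nonneg _)]

/-! ### Elementary integrals -/

/-- Lebesgue measure on `[0, ∞)`. -/
abbrev halfLine : Measure ℝ := volume.restrict (Set.Ici (0 : ℝ))

lemma memLp_indicator_Icc (t : ℝ≥0) (p : ℝ≥0∞) :
    MemLp ((Set.Icc (0 : ℝ) t).indicator fun _ => (1 : ℝ)) p halfLine :=
  memLp_indicator_const p measurableSet_Icc 1 (Or.inr (by
    refine (lt_of_le_of_lt (Measure.restrict_apply_le _ _) ?_).ne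
    simp))

lemma memLp_stepFun (c : ℝ≥0 →₀ ℝ) (p : ℝ≥0∞) : MemLp (stepFun c) p halfLine := by
  have : stepFun c = fun s => ∑ t ∈ c.support,
      c t * (Set.Icc (0 : ℝ) t).indicator (fun _ => (1 : ℝ)) s := rfl
  rw [this]
  exact memLp_finsetSum _ fun t _ => (memLp_indicator_Icc t p).const_mul _

lemma stepFun_add (c d : ℝ≥0 →₀ ℝ) (s : ℝ) : stepFun (c + d) s = stepFun c s + stepFun d s :=
  Finsupp.sum_add_index' (by simp) (by intros; ring)

lemma stepFun_smul (a : ℝ) (c : ℝ≥0 →₀ ℝ) (s : ℝ) : stepFun (a • c) s = a * stepFun c s := by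
  unfold stepFun
  rw [Finsupp.sum_smul_index (by simp), Finsupp.mul_sum]
  simp only [mul_assoc]

lemma stepFun_single (t : ℝ≥0) (x s : ℝ) :
    stepFun (Finsupp.single t x) s = x * (Set.Icc (0 : ℝ) t).indicator (fun _ => (1 : ℝ)) s :=
  Finsupp.sum_single_index (by simp)

lemma stepIntegral_add {Ω' : Type*} (W : ℝ≥0 → Ω' → ℝ) (c d : ℝ≥0 →₀ ℝ) (ω : Ω') :
    stepIntegral W (c + d) ω = stepIntegral W c ω + stepIntegral W d ω :=
  Finsupp.sum_add_index' (by simp) (by intros; ring)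

lemma stepIntegral_smul {Ω' : Type*} (W : ℝ≥0 → Ω' → ℝ) (a : ℝ) (c : ℝ≥0 →₀ ℝ) (ω : Ω') :
    stepIntegral W (a • c) ω = a * stepIntegral W c ω := by
  unfold stepIntegral
  rw [Finsupp.sum_smul_index (by simp), Finsupp.mul_sum]
  simp only [mul_assoc]

lemma stepIntegral_single {Ω' : Type*} (W : ℝ≥0 → Ω' → ℝ) (t : ℝ≥0) (x : ℝ) (ω : Ω') :
    stepIntegral W (Finsupp.single t x) ω = x * W t ω :=
  Finsupp.sum_single_index (by simp)

lemma integral_indicator_Icc_mul (s t : ℝ≥0) :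
    ∫ u, (Set.Icc (0 : ℝ) s).indicator (fun _ => (1 : ℝ)) u *
      (Set.Icc (0 : ℝ) t).indicator (fun _ => (1 : ℝ)) u ∂halfLine = min s t := by
  have h : ∀ u, (Set.Icc (0 : ℝ) s).indicator (fun _ => (1 : ℝ)) u *
      (Set.Icc (0 : ℝ) t).indicator (fun _ => (1 : ℝ)) u =
      (Set.Icc (0 : ℝ) (min s t : ℝ≥0)).indicator (fun _ => (1 : ℝ)) u := by
    intro u
    simp only [Set.indicator_apply, Set.mem_Icc, NNReal.coe_min, le_min_iff]
    split_ifs <;> simp_all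
  simp only [h]
  rw [integral_indicator measurableSet_Icc, Measure.restrict_restrict measurableSet_Icc,
    Set.inter_eq_left.2 (fun x hx => hx.1)]
  simp

variable {P : Measure Ω} {W : ℝ≥0 → Ω → ℝ}

/-- Itô isometry on step functions: the Brownian covariance `min s t` is the `L²` inner product of
`1_{[0,s]}` and `1_{[0,t]}`, and both sides are bilinear in the coefficients. -/
lemma variance_stepIntegral (hW : IsPreBrownianReal W P) (c : ℝ≥0 →₀ ℝ) :
    Var[stepIntegral W c; P] = ∫ s, stepFun c s ^ 2 ∂halfLine := by
  have : IsProbabilityMeasure P := hW.isGaussianProcess.isProbabilityMeasure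
  have hm : ∀ t, MemLp (W t) 2 P := fun t => (hW.isGaussianProcess.hasGaussianLaw_eval t).memLp_two
  have hm' : ∀ t, MemLp (fun ω => c t * W t ω) 2 P := fun t => (hm t).const_mul _
  have e1 : stepIntegral W c = fun ω => ∑ t ∈ c.support, c t * W t ω := rfl
  have e2 : ∀ s, stepFun c s ^ 2 = ∑ i ∈ c.support, ∑ j ∈ c.support, c i * c j *
      ((Set.Icc (0 : ℝ) i).indicator (fun _ => (1 : ℝ)) s *
        (Set.Icc (0 : ℝ) j).indicator (fun _ => (1 : ℝ)) s) := by
    intro s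
    rw [pow_two]
    simp only [stepFun, Finsupp.sum, Finset.sum_mul_sum]
    exact Finset.sum_congr rfl fun i _ => Finset.sum_congr rfl fun j _ => by ring
  have hint : ∀ i j : ℝ≥0, Integrable (fun s => c i * c j *
      ((Set.Icc (0 : ℝ) i).indicator (fun _ => (1 : ℝ)) s *
        (Set.Icc (0 : ℝ) j).indicator (fun _ => (1 : ℝ)) s)) halfLine := fun i j =>
    ((memLp_indicator_Icc i 2).integrable_mul (memLp_indicator_Icc j 2)).const_mul _
  rw [← covariance_self (by rw [e1]; exact Finset.aemeasurable_fun_sum _ fun t _ =>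
    (hm' t).aestronglyMeasurable.aemeasurable)]
  simp only [e2]
  rw [integral_finsetSum _ fun i _ => integrable_finsetSum _ fun j _ => hint i j, e1,
    covariance_fun_sum_left' (fun i _ => hm' i) (memLp_finsetSum _ fun i _ => hm' i)]
  refine Finset.sum_congr rfl fun i _ => ?_
  rw [integral_finsetSum _ fun j _ => hint i j,
    covariance_fun_sum_right' (fun i _ => hm' i) (hm' i)]
  refine Finset.sum_congr rfl fun j _ => ?_
  rw [covariance_const_mul_left, covariance_const_mul_right, hW.covariance_fun_eval,
    integral_const_mul, integral_indicator_Icc_mul]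
  ring

lemma hasLaw_stepIntegral (hW : IsPreBrownianReal W P) (c : ℝ≥0 →₀ ℝ) :
    HasLaw (stepIntegral W c) (gaussianReal 0 (∫ s, stepFun c s ^ 2 ∂halfLine).toNNReal) P := by
  have hg : HasGaussianLaw (stepIntegral W c) P := by
    have h := (hW.isGaussianProcess.smul (fun t => c t)).hasGaussianLaw_fun_sum (I := c.support)
    exact h
  refine ⟨hg.aemeasurable, ?_⟩
  rw [hg.map_eq_gaussianReal, variance_stepIntegral hW]
  congr 1
  have e1 : stepIntegral W c = fun ω => ∑ t ∈ c.support, c t * W t ω := rfl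
  rw [e1, integral_finsetSum _ fun t _ => (hW.integrable_eval t).const_mul _]
  simp [integral_const_mul, hW.integral_eval]

lemma eLpNorm_stepIntegral (hW : IsPreBrownianReal W P) (c : ℝ≥0 →₀ ℝ) (p : ℝ≥0∞) :
    eLpNorm (stepIntegral W c) p P = eLpNorm (stepFun c) 2 halfLine * gaussianMoment p := by
  rw [eLpNorm_of_hasLaw_gaussianReal (hasLaw_stepIntegral hW c),
    eLpNorm_two_eq_sqrt_integral (memLp_stepFun c 2),
    Real.coe_toNNReal _ (integral_nonneg fun _ => sq_nonneg _)]

lemma aestronglyMeasurable_stepIntegral (hW : IsPreBrownianReal W P) (c : ℝ≥0 →₀ ℝ) :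
    AEStronglyMeasurable (stepIntegral W c) P :=
  (hasLaw_stepIntegral hW c).aemeasurable.aestronglyMeasurable

lemma gaussianMoment_two : gaussianMoment 2 = 1 := by
  rw [gaussianMoment, eLpNorm_two_eq_sqrt_integral (memLp_id_gaussianReal' 2 (by norm_num))]
  have h := variance_id_gaussianReal (μ := 0) (v := 1)
  rw [variance_eq_sub (memLp_id_gaussianReal' 2 (by norm_num))] at h
  simp [integral_id_gaussianReal] at h
  simp [h]

/-! ### Wiener integrals -/

/-- For step functions this is an equality. An `L²`-approximating sequence has an almost surely
convergent subsequence, and Fatou's lemma passes the bound to the limit; this yields every finite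
`p` although the approximation is only in `L²`. -/
lemma IsWienerIntegral.eLpNorm_le (hW : IsPreBrownianReal W P) {f : ℝ → ℝ} {I : Ω → ℝ}
    (h : IsWienerIntegral W P f I) (p : ℝ≥0∞) (hp : p ≠ ∞) :
    eLpNorm I p P ≤ gaussianMoment p * eLpNorm f 2 halfLine := by
  obtain ⟨hf, hI, c, hc, hcI⟩ := h
  have hm := fun n => aestronglyMeasurable_stepIntegral hW (c n)
  obtain ⟨φ, hφ, hae⟩ := (tendstoInMeasure_of_tendsto_eLpNorm (by norm_num : (2 : ℝ≥0∞) ≠ 0)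
    hm hI.aestronglyMeasurable hcI).exists_seq_tendsto_ae
  refine (Lp.eLpNorm_lim_le_liminf_eLpNorm (fun n => hm (φ n)) I hae).trans ?_
  have hlim : Tendsto (fun n => gaussianMoment p * (eLpNorm (fun s => stepFun (c (φ n)) s - f s) 2
      halfLine + eLpNorm f 2 halfLine)) atTop (𝓝 (gaussianMoment p * eLpNorm f 2 halfLine)) := by
    have h1 := (hc.comp hφ.tendsto_atTop).add_const (eLpNorm f 2 halfLine)
    rw [zero_add] at h1
    exact ENNReal.Tendsto.const_mul h1 (Or.inr (gaussianMoment_ne_top hp))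
  refine (liminf_le_liminf ?_).trans hlim.liminf_eq.le
  filter_upwards with n
  rw [eLpNorm_stepIntegral hW, mul_comm]
  gcongr
  have : stepFun (c (φ n)) = (fun s => stepFun (c (φ n)) s - f s) + f := by ext; simp
  conv_lhs => rw [this]
  exact eLpNorm_add_le ((memLp_stepFun _ 2).sub hf).aestronglyMeasurable hf.aestronglyMeasurable
    (by norm_num)

lemma IsWienerIntegral.congr {f g : ℝ → ℝ} {I J : Ω → ℝ}
    (h : IsWienerIntegral W P f I) (hfg : f =ᵐ[halfLine] g) (hIJ : I =ᵐ[P] J) :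
    IsWienerIntegral W P g J := by
  obtain ⟨hf, hI, c, hc, hcI⟩ := h
  refine ⟨hf.ae_eq hfg, hI.ae_eq hIJ, c, hc.congr fun n => eLpNorm_congr_ae ?_,
    hcI.congr fun n => eLpNorm_congr_ae ?_⟩
  · filter_upwards [hfg] with x hx using by rw [hx]
  · filter_upwards [hIJ] with x hx using by rw [hx]

lemma IsWienerIntegral.add (hW : IsPreBrownianReal W P) {f g : ℝ → ℝ} {I J : Ω → ℝ}
    (h : IsWienerIntegral W P f I) (h' : IsWienerIntegral W P g J) :
    IsWienerIntegral W P (fun s => f s + g s) (fun ω => I ω + J ω) := by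
  obtain ⟨hf, hI, c, hc, hcI⟩ := h
  obtain ⟨hg, hJ, d, hd, hdJ⟩ := h'
  refine ⟨hf.add hg, hI.add hJ, fun n => c n + d n, ?_, ?_⟩
  · refine tendsto_of_tendsto_of_tendsto_of_le_of_le tendsto_const_nhds (by simpa using hc.add hd)
      (fun _ => zero_le) fun n => ?_
    refine le_trans (eLpNorm_congr_ae (.of_forall fun s => ?_)).le (eLpNorm_add_le
      ((memLp_stepFun (c n) 2).sub hf).aestronglyMeasurable
      ((memLp_stepFun (d n) 2).sub hg).aestronglyMeasurable (by norm_num))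
    simp only [stepFun_add, Pi.add_apply]
    ring
  · refine tendsto_of_tendsto_of_tendsto_of_le_of_le tendsto_const_nhds (by simpa using hcI.add hdJ)
      (fun _ => zero_le) fun n => ?_
    refine le_trans (eLpNorm_congr_ae (.of_forall fun s => ?_)).le (eLpNorm_add_le
      ((aestronglyMeasurable_stepIntegral hW (c n)).sub hI.aestronglyMeasurable)
      ((aestronglyMeasurable_stepIntegral hW (d n)).sub hJ.aestronglyMeasurable) (by norm_num))
    simp only [stepIntegral_add, Pi.add_apply]
    ring

lemma IsWienerIntegral.const_mul {f : ℝ → ℝ} {I : Ω → ℝ}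
    (h : IsWienerIntegral W P f I) (a : ℝ) :
    IsWienerIntegral W P (fun s => a * f s) (fun ω => a * I ω) := by
  obtain ⟨hf, hI, c, hc, hcI⟩ := h
  refine ⟨hf.const_mul a, hI.const_mul a, fun n => a • c n, ?_, ?_⟩
  · have := ENNReal.Tendsto.const_mul (a := ‖a‖ₑ) hc (Or.inr (by simp))
    rw [mul_zero] at this
    refine this.congr fun n => ?_
    rw [← eLpNorm_const_smul]
    refine eLpNorm_congr_ae (.of_forall fun s => ?_)
    simp only [stepFun_smul, Pi.smul_apply, smul_eq_mul]
    ring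
  · have := ENNReal.Tendsto.const_mul (a := ‖a‖ₑ) hcI (Or.inr (by simp))
    rw [mul_zero] at this
    refine this.congr fun n => ?_
    rw [← eLpNorm_const_smul]
    refine eLpNorm_congr_ae (.of_forall fun s => ?_)
    simp only [stepIntegral_smul, Pi.smul_apply, smul_eq_mul]
    ring

lemma IsWienerIntegral.sub (hW : IsPreBrownianReal W P) {f g : ℝ → ℝ} {I J : Ω → ℝ}
    (h : IsWienerIntegral W P f I) (h' : IsWienerIntegral W P g J) :
    IsWienerIntegral W P (fun s => f s - g s) (fun ω => I ω - J ω) := by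
  convert h.add hW (h'.const_mul (-1)) using 2 <;> ring

lemma isWienerIntegral_zero : IsWienerIntegral W P (fun _ => 0) (fun _ => 0) := by
  refine ⟨MemLp.zero, MemLp.zero, fun _ => 0, ?_, ?_⟩ <;>
    simp [stepFun, stepIntegral]

lemma IsWienerIntegral.sum (hW : IsPreBrownianReal W P) {ι : Type*} (A : Finset ι)
    {f : ι → ℝ → ℝ} {I : ι → Ω → ℝ} (h : ∀ i ∈ A, IsWienerIntegral W P (f i) (I i)) :
    IsWienerIntegral W P (fun s => ∑ i ∈ A, f i s) (fun ω => ∑ i ∈ A, I i ω) := by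
  classical
  induction A using Finset.induction_on with
  | empty => simpa using isWienerIntegral_zero
  | insert a A ha ih =>
    simp only [Finset.sum_insert ha]
    exact (h a (by simp)).add hW (ih fun i hi => h i (by simp [hi]))

lemma isWienerIntegral_stepIntegral (hW : IsPreBrownianReal W P) (c : ℝ≥0 →₀ ℝ) :
    IsWienerIntegral W P (stepFun c) (stepIntegral W c) := by
  refine ⟨memLp_stepFun c 2, ⟨aestronglyMeasurable_stepIntegral hW c, ?_⟩, fun _ => c, ?_, ?_⟩
  · rw [eLpNorm_stepIntegral hW, gaussianMoment_two, mul_one]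
    exact (memLp_stepFun c 2).2
  · simp
  · simp

lemma isWienerIntegral_increment (hW : IsPreBrownianReal W P) {a b : ℝ≥0} (hab : a ≤ b) :
    IsWienerIntegral W P ((Set.Ioc (a : ℝ) b).indicator fun _ => 1)
      (fun ω => W b ω - W a ω) := by
  refine ((isWienerIntegral_stepIntegral hW (Finsupp.single b 1)).sub hW
    (isWienerIntegral_stepIntegral hW (Finsupp.single a 1))).congr ?_ ?_
  · filter_upwards [ae_restrict_mem measurableSet_Ici] with s hs
    have hs : 0 ≤ s := hs
    have hab' : (a : ℝ) ≤ b := hab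
    simp only [stepFun_single, one_mul, Set.indicator_apply, Set.mem_Icc, Set.mem_Ioc, hs,
      true_and]
    split_ifs <;> grind
  · filter_upwards with ω
    simp [stepIntegral_single]

/-- The span of the indicators `1_{[0,t]}` is dense in `L²([0,∞))`. -/
lemma topologicalClosure_span_indicator_Icc :
    (Submodule.span ℝ (Set.range fun t : ℝ≥0 =>
      (memLp_indicator_Icc t 2).toLp)).topologicalClosure = ⊤ := by
  rw [Submodule.topologicalClosure_eq_top_iff, Submodule.eq_bot_iff]
  intro g hg
  -- Orthogonality to every `1_{[0,t]}` says that the primitive of `g` vanishes; Lebesgue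
  -- differentiation then gives `g = 0` almost everywhere.
  have hg0 : ∀ t : ℝ≥0, ∫ s in (0 : ℝ)..t, g s = 0 := by
    intro t
    have h := (Submodule.mem_orthogonal _ _).1 hg _ (Submodule.subset_span ⟨t, rfl⟩)
    rw [L2.inner_def] at h
    have h2 : ∀ᵐ s ∂halfLine, inner ℝ (MemLp.toLp _ (memLp_indicator_Icc t 2) s) (g s) =
        (Set.Icc (0 : ℝ) t).indicator (fun s => g s) s := by
      filter_upwards [(memLp_indicator_Icc t 2).coeFn_toLp] with s hs
      rw [hs]
      by_cases h : s ∈ Set.Icc (0 : ℝ) t <;> simp [h]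
    rw [integral_congr_ae h2, integral_indicator measurableSet_Icc,
      Measure.restrict_restrict measurableSet_Icc, Set.inter_eq_left.2 (fun x hx => hx.1)] at h
    rw [intervalIntegral.integral_of_le t.coe_nonneg, ← integral_Icc_eq_integral_Ioc, h]
  have hloc : LocallyIntegrable ((Set.Ici (0 : ℝ)).indicator fun s => g s) volume := by
    have : MemLp ((Set.Ici (0 : ℝ)).indicator fun s => g s) 2 volume :=
      (memLp_indicator_iff_restrict measurableSet_Ici).2 (Lp.memLp g)
    exact this.locallyIntegrable (by norm_num)
  rw [Lp.ext_iff]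
  have hae := (ae_restrict_of_ae (s := Set.Ici (0:ℝ)) (LocallyIntegrable.ae_hasDerivAt_integral hloc))
  have hne : ∀ᵐ s ∂halfLine, s ≠ 0 := ae_restrict_of_ae (Measure.ae_ne volume 0)
  filter_upwards [hae, hne, ae_restrict_mem measurableSet_Ici, Lp.coeFn_zero ℝ 2 halfLine]
    with x hx hx0 hx1 hx2
  have hx1 : 0 ≤ x := hx1
  have hpos : 0 < x := lt_of_le_of_ne hx1 hx0.symm
  have hd := hx 0
  have hev : (fun u => ∫ s in (0 : ℝ)..u, (Set.Ici (0 : ℝ)).indicator (fun s => g s) s)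
      =ᶠ[𝓝 x] fun _ => 0 := by
    filter_upwards [lt_mem_nhds hpos] with u hu
    refine (intervalIntegral.integral_congr fun s hs => ?_).trans (hg0 ⟨u, hu.le⟩)
    rw [Set.uIcc_of_le hu.le] at hs
    simp [Set.indicator_of_mem (show s ∈ Set.Ici (0 : ℝ) from hs.1)]
  have h0 := (hd.congr_of_eventuallyEq hev.symm).unique (hasDerivAt_const x 0)
  rw [hx2]
  simpa [Set.indicator_of_mem (show x ∈ Set.Ici (0 : ℝ) from hx1)] using h0

lemma exists_ae_eq_stepFun {g : Lp ℝ 2 halfLine} (hg : g ∈ Submodule.span ℝ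
    (Set.range fun t : ℝ≥0 => (memLp_indicator_Icc t 2).toLp)) :
    ∃ c : ℝ≥0 →₀ ℝ, g =ᵐ[halfLine] stepFun c := by
  induction hg using Submodule.span_induction with
  | mem g hg =>
    obtain ⟨t, rfl⟩ := hg
    refine ⟨Finsupp.single t 1, (memLp_indicator_Icc t 2).coeFn_toLp.trans ?_⟩
    exact .of_forall fun s => by simp only [stepFun_single, one_mul]
  | zero => exact ⟨0, (Lp.coeFn_zero ℝ 2 halfLine).trans (.of_forall fun s => by simp [stepFun])⟩
  | add g h _ _ hg hh =>
    obtain ⟨c, hc⟩ := hg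
    obtain ⟨d, hd⟩ := hh
    refine ⟨c + d, ?_⟩
    filter_upwards [hc, hd, Lp.coeFn_add g h] with s h1 h2 h3
    rw [h3, stepFun_add, Pi.add_apply, h1, h2]
  | smul a g _ hg =>
    obtain ⟨c, hc⟩ := hg
    refine ⟨a • c, ?_⟩
    filter_upwards [hc, Lp.coeFn_smul a g] with s h1 h2
    rw [h2, stepFun_smul, Pi.smul_apply, h1, smul_eq_mul]

lemma exists_stepFun_approx {f : ℝ → ℝ} (hf : MemLp f 2 halfLine) {ε : ℝ} (hε : 0 < ε) :
    ∃ c : ℝ≥0 →₀ ℝ, eLpNorm (fun s => stepFun c s - f s) 2 halfLine < ENNReal.ofReal ε := by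
  have hmem : hf.toLp ∈ (Submodule.span ℝ (Set.range fun t : ℝ≥0 =>
      (memLp_indicator_Icc t 2).toLp)).topologicalClosure := by
    rw [topologicalClosure_span_indicator_Icc]; trivial
  obtain ⟨g, hg, hgd⟩ := Metric.mem_closure_iff.1 hmem ε hε
  obtain ⟨c, hc⟩ := exists_ae_eq_stepFun hg
  refine ⟨c, ?_⟩
  have h : edist g hf.toLp < ENNReal.ofReal ε := by
    rw [edist_dist, dist_comm]
    exact (ENNReal.ofReal_lt_ofReal_iff hε).2 hgd
  rw [Lp.edist_def] at h
  refine lt_of_eq_of_lt (eLpNorm_congr_ae ?_) h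
  filter_upwards [hc, hf.coeFn_toLp] with s h1 h2
  simp [h1, h2]

/-- Elementary integration is an isometry from step functions to `L²(P)`, so it carries an
approximating sequence of `f` to a Cauchy sequence, and `L²(P)` is complete. -/
lemma exists_isWienerIntegral (hW : IsPreBrownianReal W P) {f : ℝ → ℝ} (hf : MemLp f 2 halfLine) :
    ∃ I, IsWienerIntegral W P f I := by
  choose c hc using fun n : ℕ => exists_stepFun_approx hf (Nat.one_div_pos_of_nat (α := ℝ) (n := n))
  have hlim : Tendsto (fun n => eLpNorm (fun s => stepFun (c n) s - f s) 2 halfLine)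
      atTop (𝓝 0) := by
    refine tendsto_of_tendsto_of_tendsto_of_le_of_le tendsto_const_nhds ?_
      (fun _ => zero_le) fun n => (hc n).le
    rw [← ENNReal.ofReal_zero]
    exact (ENNReal.continuous_ofReal.tendsto 0).comp tendsto_one_div_add_atTop_nhds_zero_nat
  have hmem : ∀ n, MemLp (stepIntegral W (c n)) 2 P := fun n =>
    (isWienerIntegral_stepIntegral hW (c n)).2.1
  have hiso : ∀ m n, edist (hmem m).toLp (hmem n).toLp =
      edist (memLp_stepFun (c m) 2).toLp (memLp_stepFun (c n) 2).toLp := by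
    intro m n
    rw [Lp.edist_toLp_toLp, Lp.edist_toLp_toLp]
    have h := eLpNorm_stepIntegral hW (c m + (-1 : ℝ) • c n) 2
    rw [gaussianMoment_two, mul_one] at h
    convert h using 2
    · ext ω; rw [stepIntegral_add, stepIntegral_smul, Pi.sub_apply]; ring
    · ext ω; rw [stepFun_add, stepFun_smul, Pi.sub_apply]; ring
  have hconv : Tendsto (fun n => (memLp_stepFun (c n) 2).toLp) atTop (𝓝 hf.toLp) := by
    rw [tendsto_iff_edist_tendsto_0]
    refine hlim.congr fun n => ?_
    rw [Lp.edist_toLp_toLp]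
    rfl
  have hcauchy : CauchySeq fun n => (hmem n).toLp := by
    have := hconv.cauchySeq
    rw [EMetric.cauchySeq_iff] at this ⊢
    intro ε hε
    obtain ⟨K, hK⟩ := this ε hε
    exact ⟨K, fun m hm n hn => by rw [hiso]; exact hK m hm n hn⟩
  obtain ⟨J, hJ⟩ := cauchySeq_tendsto_of_complete hcauchy
  refine ⟨J, hf, Lp.memLp J, c, hlim, ?_⟩
  rw [tendsto_iff_edist_tendsto_0] at hJ
  refine hJ.congr fun n => ?_
  rw [Lp.edist_def]
  refine eLpNorm_congr_ae ?_
  filter_upwards [(hmem n).coeFn_toLp] with ω hω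
  simp [hω]

/-- Ensures that the default value `0` in `wienerIntegral` is never taken for square integrable `f`.
-/
lemma isWienerIntegral_wienerIntegral (hW : IsPreBrownianReal W P) {f : ℝ → ℝ}
    (hf : MemLp f 2 halfLine) : IsWienerIntegral W P f (wienerIntegral W P f) := by
  have h := exists_isWienerIntegral hW hf
  rw [wienerIntegral, dif_pos h]
  exact h.choose_spec

end

section

/-! ### Kernel estimates -/

/-- The kernel equal to `v^ζ` on `(0,h]` and to `h v^(ζ-1)` on `(h,∞)`, which dominates
increments of the power kernel at scale `h`. -/
def domKernel (ζ h v : ℝ) : ℝ :=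
  (Set.Ioc 0 h).indicator (fun v => v ^ ζ) v + (Set.Ioi h).indicator (fun v => h * v ^ (ζ - 1)) v

lemma domKernel_of_le {ζ h v : ℝ} (hv : 0 < v) (hvh : v ≤ h) : domKernel ζ h v = v ^ ζ := by
  simp [domKernel, hv, hvh]

lemma domKernel_of_lt {ζ h v : ℝ} (hvh : h < v) : domKernel ζ h v = h * v ^ (ζ - 1) := by
  simp [domKernel, hvh]

lemma domKernel_nonneg {ζ h : ℝ} (hh : 0 ≤ h) (v : ℝ) : 0 ≤ domKernel ζ h v := by
  refine add_nonneg (Set.indicator_nonneg (fun v hv => Real.rpow_nonneg hv.1.le _) _)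
    (Set.indicator_nonneg (fun v hv => mul_nonneg hh (Real.rpow_nonneg (hh.trans hv.le) _)) _)

lemma measurable_domKernel (ζ h : ℝ) : Measurable (domKernel ζ h) :=
  ((by fun_prop : Measurable fun v : ℝ => v ^ ζ).indicator measurableSet_Ioc).add
    ((by fun_prop : Measurable fun v : ℝ => h * v ^ (ζ - 1)).indicator measurableSet_Ioi)

/-- The two pieces have disjoint supports, so the cross term vanishes. -/
lemma sq_domKernel {ζ h : ℝ} (hh : 0 < h) (v : ℝ) : domKernel ζ h v ^ 2 =
    (Set.Ioc 0 h).indicator (fun v => v ^ (2 * ζ)) v +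
      (Set.Ioi h).indicator (fun v => h ^ 2 * v ^ (2 * ζ - 2)) v := by
  rcases le_or_gt v 0 with hv | hv
  · simp [domKernel, hv.not_gt, (hv.trans hh.le).not_gt]
  rcases le_or_gt v h with hvh | hvh
  · rw [domKernel_of_le hv hvh]
    simp only [Set.indicator_apply, Set.mem_Ioc, hv, hvh, Set.mem_Ioi, hvh.not_gt]
    rw [mul_comm, Real.rpow_mul hv.le]
    simp
  · rw [domKernel_of_lt hvh]
    simp only [Set.indicator_apply, Set.mem_Ioc, hv, hvh.not_ge, Set.mem_Ioi, hvh]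
    have e : v ^ (2 * ζ - 2) = (v ^ (ζ - 1)) ^ 2 := by
      rw [← Real.rpow_natCast, ← Real.rpow_mul hv.le]; congr 1; push_cast; ring
    simp [mul_pow, e]

/-- The constant in the `L²` norm of `domKernel`. -/
def domConst (H : ℝ) : ℝ := √(1 / (2 * H) + 1 / (2 - 2 * H))

variable {H : ℝ}

lemma integrableOn_Ioc_rpow (hH0 : 0 < H) (h : ℝ) :
    IntegrableOn (fun v : ℝ => v ^ (2 * (H - 1 / 2))) (Set.Ioc 0 h) := by
  rcases le_total 0 h with hh | hh
  · rw [← intervalIntegrable_iff_integrableOn_Ioc_of_le hh]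
    exact intervalIntegral.intervalIntegrable_rpow' (by linarith)
  · simp [hh]

lemma integrable_sq_domKernel (hH0 : 0 < H) (hH1 : H < 1) {h : ℝ} (hh : 0 < h) :
    Integrable (fun v => domKernel (H - 1 / 2) h v ^ 2) := by
  simp only [sq_domKernel hh]
  refine ((integrableOn_Ioc_rpow hH0 h).integrable_indicator measurableSet_Ioc).add
    (IntegrableOn.integrable_indicator ?_ measurableSet_Ioi)
  exact (integrableOn_Ioi_rpow_of_lt (by linarith) hh).const_mul _

lemma memLp_domKernel (hH0 : 0 < H) (hH1 : H < 1) {h : ℝ} (hh : 0 < h) :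
    MemLp (domKernel (H - 1 / 2) h) 2 :=
  (memLp_two_iff_integrable_sq (measurable_domKernel _ _).aestronglyMeasurable).2
    (integrable_sq_domKernel hH0 hH1 hh)

/-- The pieces contribute `h^(2H) / (2H)` and `h^(2H) / (2 - 2H)`; `H > 0` gives integrability at
`0` and `H < 1` at infinity. -/
lemma integral_sq_domKernel (hH0 : 0 < H) (hH1 : H < 1) {h : ℝ} (hh : 0 < h) :
    ∫ v, domKernel (H - 1 / 2) h v ^ 2 = (domConst H * h ^ H) ^ 2 := by
  simp only [sq_domKernel hh]
  rw [integral_add ((integrableOn_Ioc_rpow hH0 h).integrable_indicator measurableSet_Ioc)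
    (IntegrableOn.integrable_indicator
      ((integrableOn_Ioi_rpow_of_lt (by linarith) hh).const_mul _) measurableSet_Ioi),
    integral_indicator measurableSet_Ioc, integral_indicator measurableSet_Ioi,
    integral_const_mul, integral_Ioi_rpow_of_lt (by linarith) hh,
    ← intervalIntegral.integral_of_le hh.le, integral_rpow (Or.inl (by linarith)),
    Real.zero_rpow (by linarith), mul_pow, domConst, Real.sq_sqrt (by
      have : 0 < 2 - 2 * H := by linarith
      positivity)]
  have e1 : h ^ (2 * (H - 1 / 2) + 1) = (h ^ H) ^ 2 := by
    rw [← Real.rpow_natCast, ← Real.rpow_mul hh.le]; congr 1; push_cast; ring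
  have e2 : h ^ 2 * h ^ (2 * (H - 1 / 2) - 2 + 1) = (h ^ H) ^ 2 := by
    rw [← Real.rpow_natCast, ← Real.rpow_natCast, ← Real.rpow_add hh, ← Real.rpow_mul hh.le]
    congr 1; push_cast; ring
  have h3 : (2 - 2 * H) ≠ 0 := by linarith
  have h4 : 2 * (H - 1 / 2) - 2 + 1 ≠ 0 := by linarith
  have e3 : h ^ 2 * (-h ^ (2 * (H - 1 / 2) - 2 + 1) / (2 * (H - 1 / 2) - 2 + 1)) =
      (h ^ H) ^ 2 * (1 / (2 - 2 * H)) := by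
    rw [← e2]
    rw [show 2 * (H - 1 / 2) - 2 + 1 = -(2 - 2 * H) by ring, neg_div_neg_eq]
    ring
  rw [e3, e1, show 2 * (H - 1 / 2) + 1 = 2 * H by ring]
  ring

lemma memLp_domKernel_sub (hH0 : 0 < H) (hH1 : H < 1) {h : ℝ} (hh : 0 < h) (t : ℝ) :
    MemLp (fun u => domKernel (H - 1 / 2) h (t - u)) 2 halfLine :=
  ((memLp_domKernel hH0 hH1 hh).comp_measurePreserving
    (Measure.measurePreserving_sub_left volume t)).restrict _

lemma eLpNorm_domKernel_sub_le (hH0 : 0 < H) (hH1 : H < 1) {h : ℝ} (hh : 0 < h) (t : ℝ) :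
    eLpNorm (fun u => domKernel (H - 1 / 2) h (t - u)) 2 halfLine ≤
      ENNReal.ofReal (domConst H * h ^ H) := by
  refine (eLpNorm_mono_measure _ Measure.restrict_le_self).trans ?_
  have := eLpNorm_comp_measurePreserving (p := 2)
    (measurable_domKernel (H - 1 / 2) h).aestronglyMeasurable (Measure.measurePreserving_sub_left volume t)
  refine (le_of_eq this).trans ?_
  rw [eLpNorm_two_eq_sqrt_integral (memLp_domKernel hH0 hH1 hh), integral_sq_domKernel hH0 hH1 hh,
    Real.sqrt_sq (by unfold domConst; positivity)]

lemma memLp_of_abs_le_domKernel (hH0 : 0 < H) (hH1 : H < 1) {h : ℝ} (hh : 0 < h) (t A : ℝ)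
    {f : ℝ → ℝ} (hf : Measurable f)
    (hle : ∀ᵐ u ∂halfLine, |f u| ≤ A * domKernel (H - 1 / 2) h (t - u)) : MemLp f 2 halfLine :=
  ((memLp_domKernel_sub hH0 hH1 hh t).const_mul A).mono' hf.aestronglyMeasurable hle

lemma measurable_powerKernel (ζ : ℝ) (a t : ℝ≥0) : Measurable (powerKernel ζ a t) :=
  (by fun_prop : Measurable fun s : ℝ => ((t : ℝ) - s) ^ ζ).indicator measurableSet_Ioc

lemma memLp_powerKernel (hH0 : 0 < H) (hH1 : H < 1) (a t : ℝ≥0) :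
    MemLp (powerKernel (H - 1 / 2) a t) 2 halfLine := by
  rcases eq_or_ne t 0 with rfl | ht
  · have : powerKernel (H - 1 / 2) a 0 = fun _ => 0 := by
      ext s
      simp only [powerKernel, Set.indicator_apply]
      rw [if_neg]
      intro h
      exact absurd (h.1.trans_le h.2) (by simp)
    rw [this]; exact MemLp.zero
  have ht : (0 : ℝ) < t := by positivity
  -- At scale `h = t` the whole interval `(0, t]` lies in the first piece of `domKernel`.
  refine memLp_of_abs_le_domKernel hH0 hH1 ht t 1 (measurable_powerKernel _ _ _) ?_
  have hne : ∀ᵐ s ∂halfLine, s ≠ (t : ℝ) := ae_restrict_of_ae (Measure.ae_ne volume _)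
  filter_upwards [hne, ae_restrict_mem measurableSet_Ici] with s hs hs0
  have hs0 : 0 ≤ s := hs0
  rw [one_mul, powerKernel, Set.indicator_apply]
  split_ifs with h
  · have : 0 < (t : ℝ) - s := sub_pos.2 (lt_of_le_of_ne h.2 hs)
    rw [domKernel_of_le this (by linarith), abs_of_nonneg (by positivity)]
  · simpa using domKernel_nonneg ht.le _

/-- Mean value theorem: the derivative `ζ y^(ζ-1)` is at most `x^(ζ-1)` in absolute value on `[x,
∞)`, since `|ζ| ≤ 1` and the exponent `ζ - 1` is nonpositive. -/
lemma abs_rpow_sub_rpow_le {ζ v w x : ℝ} (hζ : |ζ| ≤ 1) (hζ1 : ζ ≤ 1) (hx : 0 < x)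
    (hv : x ≤ v) (hw : x ≤ w) : |v ^ ζ - w ^ ζ| ≤ x ^ (ζ - 1) * |v - w| := by
  refine (convex_Ici x).norm_image_sub_le_of_norm_hasDerivWithin_le (f := fun v => v ^ ζ)
    (f' := fun v => ζ * v ^ (ζ - 1)) (fun y hy => ?_) (fun y hy => ?_) hw hv
  · exact (Real.hasDerivAt_rpow_const (Or.inl (hx.trans_le hy).ne')).hasDerivWithinAt
  · have hy0 : 0 < y := hx.trans_le hy
    rw [norm_mul, Real.norm_eq_abs, Real.norm_eq_abs, abs_of_pos (Real.rpow_pos_of_pos hy0 _)]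
    calc |ζ| * y ^ (ζ - 1) ≤ 1 * x ^ (ζ - 1) := by
          exact mul_le_mul hζ (Real.rpow_le_rpow_of_nonpos hx hy (by linarith))
            (Real.rpow_nonneg hy0.le _) zero_le_one
      _ = _ := one_mul _

lemma abs_half_sub_le (hH0 : 0 < H) (hH1 : H < 1) : |H - 1 / 2| ≤ 1 := by
  rw [abs_le]; constructor <;> linarith

/-- Let `h = t - s`. For `s < u < t` only the kernel at `t` is present, within distance `h` of its
singularity. For `u` within `h` below `s` the two kernels are bounded separately. Further to the
left the mean value theorem gives the tail `h v^(ζ-1)` with `v = s - u`. The exceptional points `0`,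
`s`, `t` form a null set. -/
lemma abs_powerKernel_sub_le (hH0 : 0 < H) (hH1 : H < 1) {s t : ℝ≥0} (hst : s < t) :
    ∀ᵐ u ∂halfLine, |powerKernel (H - 1 / 2) 0 t u - powerKernel (H - 1 / 2) 0 s u| ≤
      2 * domKernel (H - 1 / 2) (t - s) (t - u) + domKernel (H - 1 / 2) (t - s) (s - u) := by
  have hne : ∀ᵐ u ∂halfLine, u ≠ (t : ℝ) := ae_restrict_of_ae (Measure.ae_ne volume _)
  have hne' : ∀ᵐ u ∂halfLine, u ≠ (s : ℝ) := ae_restrict_of_ae (Measure.ae_ne volume _)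
  have hne0 : ∀ᵐ u ∂halfLine, u ≠ (0 : ℝ) := ae_restrict_of_ae (Measure.ae_ne volume _)
  filter_upwards [hne, hne', hne0, ae_restrict_mem measurableSet_Ici] with u hut hus hu0 hu
  have hu : 0 < u := lt_of_le_of_ne hu hu0.symm
  have hst' : (s : ℝ) < t := hst
  have hh : (0 : ℝ) < t - s := sub_pos.2 hst'
  have d1 := domKernel_nonneg (ζ := H - 1 / 2) hh.le (t - u)
  have d2 := domKernel_nonneg (ζ := H - 1 / 2) hh.le (s - u)
  set h : ℝ := t - s with hdef
  rcases lt_or_gt_of_ne hut with hut | hut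
  swap
  · have e1 : powerKernel (H - 1 / 2) 0 t u = 0 := by
      simp [powerKernel, hut.not_ge]
    have e2 : powerKernel (H - 1 / 2) 0 s u = 0 := by
      simp [powerKernel, (hst'.trans hut).not_ge]
    rw [e1, e2]; simp only [sub_zero, abs_zero]; positivity
  have e1 : powerKernel (H - 1 / 2) 0 t u = (t - u) ^ (H - 1 / 2) := by
    simp [powerKernel, hut.le, hu]
  rw [e1]
  have hv : (0 : ℝ) < t - u := sub_pos.2 hut
  have hvp : 0 ≤ ((t : ℝ) - u) ^ (H - 1 / 2) := by positivity
  rcases lt_or_gt_of_ne hus with hus | hus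
  swap
  · have e2 : powerKernel (H - 1 / 2) 0 s u = 0 := by
      simp [powerKernel, hus.not_ge]
    rw [domKernel_of_le hv (by linarith)] at d1 ⊢
    rw [e2, sub_zero, abs_of_nonneg hvp]
    linarith
  have e2 : powerKernel (H - 1 / 2) 0 s u = (s - u) ^ (H - 1 / 2) := by
    simp [powerKernel, hus.le, hu]
  rw [e2]
  have hw : (0 : ℝ) < s - u := sub_pos.2 hus
  have hwp : 0 ≤ ((s : ℝ) - u) ^ (H - 1 / 2) := by positivity
  rcases le_or_gt ((s : ℝ) - u) h with hwh | hwh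
  · have hvh : h < t - u := by linarith
    -- Here `h < t - u ≤ 2h`, which is the source of the factor `2`.
    have h1 : ((t : ℝ) - u) ^ (H - 1 / 2) ≤ 2 * domKernel (H - 1 / 2) h (t - u) := by
      rw [domKernel_of_lt hvh]
      have : ((t : ℝ) - u) ^ (H - 1 / 2) = (t - u) * ((t : ℝ) - u) ^ (H - 1 / 2 - 1) := by
        rw [Real.rpow_sub_one hv.ne']; field_simp
      rw [this, ← mul_assoc]
      gcongr
      linarith
    rw [domKernel_of_le hw hwh]
    rw [abs_le]
    constructor <;> linarith
  · rw [domKernel_of_lt (h := h) (v := s - u) hwh] at d2 ⊢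
    have h1 := abs_rpow_sub_rpow_le (abs_half_sub_le hH0 hH1) (by linarith) hw
      (by linarith : (s : ℝ) - u ≤ t - u) le_rfl
    rw [show (t : ℝ) - u - (s - u) = h by rw [hdef]; ring, abs_of_pos hh] at h1
    linarith

lemma eLpNorm_powerKernel_sub_le (hH0 : 0 < H) (hH1 : H < 1) {s t : ℝ≥0} (hst : s < t) :
    eLpNorm (fun u => powerKernel (H - 1 / 2) 0 t u - powerKernel (H - 1 / 2) 0 s u) 2 halfLine ≤
      ENNReal.ofReal (3 * domConst H * (t - s : ℝ) ^ H) := by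
  have hh : (0 : ℝ) < t - s := sub_pos.2 hst
  have hD : 0 ≤ domConst H := Real.sqrt_nonneg _
  have m1 := (memLp_domKernel_sub hH0 hH1 hh t).const_mul 2
  have m2 := memLp_domKernel_sub hH0 hH1 hh s
  refine (eLpNorm_mono_ae_real (abs_powerKernel_sub_le hH0 hH1 hst)).trans ?_
  refine (eLpNorm_add_le m1.aestronglyMeasurable m2.aestronglyMeasurable (by norm_num)).trans ?_
  have e : (fun u : ℝ => 2 * domKernel (H - 1 / 2) (t - s) (t - u)) =
      (2 : ℝ) • fun u : ℝ => domKernel (H - 1 / 2) (t - s) (t - u) := rfl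
  have e3 : ENNReal.ofReal (3 * domConst H * (t - s : ℝ) ^ H) =
      ‖(2 : ℝ)‖ₑ * ENNReal.ofReal (domConst H * (t - s : ℝ) ^ H) +
        ENNReal.ofReal (domConst H * (t - s : ℝ) ^ H) := by
    rw [Real.enorm_eq_ofReal (by norm_num), ← ENNReal.ofReal_mul (by norm_num),
      ← ENNReal.ofReal_add (by positivity) (by positivity)]
    congr 1; ring
  rw [e, eLpNorm_const_smul, e3]
  gcongr
  · exact eLpNorm_domKernel_sub_le hH0 hH1 hh t
  · exact eLpNorm_domKernel_sub_le hH0 hH1 hh s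

/-! ### The kernel of the hybrid scheme at the partition points -/

variable {T : ℝ≥0} {N : ℕ}

lemma mesh_pos (hT : 0 < T) (hN : 0 < N) : 0 < mesh T N := by
  unfold mesh; positivity

lemma coe_node (T : ℝ≥0) (N k : ℕ) : (node T N k : ℝ) = k * mesh T N := by
  simp [node]

/-- The kernel of the discretised part of the hybrid scheme at the node `t_k`. -/
def nodeKernel (H : ℝ) (T : ℝ≥0) (N k : ℕ) (u : ℝ) : ℝ :=
  powerKernel (H - 1 / 2) (node T N (k - 1)) (node T N k) u +
    ∑ i ∈ Finset.Icc 2 k, weight H T N i *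
      (Set.Ioc (node T N (k - i) : ℝ) (node T N (k - i + 1))).indicator (fun _ => (1 : ℝ)) u

lemma mem_Ioc_node_iff (hm : 0 < mesh T N) {u : ℝ} (m : ℕ) :
    u ∈ Set.Ioc (node T N m : ℝ) (node T N (m + 1)) ↔ ⌈u / mesh T N⌉₊ = m + 1 := by
  have hm : (0 : ℝ) < mesh T N := hm
  rw [Nat.ceil_eq_iff (by omega), coe_node, coe_node, Set.mem_Ioc, lt_div_iff₀ hm, div_le_iff₀ hm]
  simp

/-- Since `b*_i` is the mean of `s^ζ` over a cell containing `v`, the difference is a mean of `v^ζ -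
s^ζ`, and the mean value bound applies to each of these. -/
lemma abs_weight_sub_le (hH0 : 0 < H) (hH1 : H < 1) (hm : 0 < mesh T N) {i : ℕ} (hi : 2 ≤ i)
    {v : ℝ} (hv1 : node T N (i - 1) ≤ v) (hv2 : v ≤ node T N i) :
    |v ^ (H - 1 / 2) - weight H T N i| ≤
      (node T N (i - 1) : ℝ) ^ (H - 1 / 2 - 1) * mesh T N := by
  have hm : (0 : ℝ) < mesh T N := hm
  have hcast : ((i - 1 : ℕ) : ℝ) = i - 1 := by
    rw [Nat.cast_sub (by omega)]; simp
  have hlen : (node T N i : ℝ) - node T N (i - 1) = mesh T N := by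
    rw [coe_node, coe_node, hcast]; ring
  have hx : (0 : ℝ) < node T N (i - 1) := by
    rw [coe_node]
    have : 0 < i - 1 := by omega
    positivity
  have hle : (node T N (i - 1) : ℝ) ≤ node T N i := by linarith
  have hint : IntervalIntegrable (fun s : ℝ => s ^ (H - 1 / 2)) volume
      (node T N (i - 1)) (node T N i) :=
    intervalIntegral.intervalIntegrable_rpow' (by linarith)
  have e : v ^ (H - 1 / 2) - weight H T N i = (mesh T N : ℝ)⁻¹ *
      ∫ s in (node T N (i - 1) : ℝ)..(node T N i : ℝ), (v ^ (H - 1 / 2) - s ^ (H - 1 / 2)) := by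
    rw [intervalIntegral.integral_sub (by simp) hint, intervalIntegral.integral_const, hlen,
      weight, smul_eq_mul]
    field_simp
  have hb : ‖∫ s in (node T N (i - 1) : ℝ)..(node T N i : ℝ),
      (v ^ (H - 1 / 2) - s ^ (H - 1 / 2))‖ ≤
      ((node T N (i - 1) : ℝ) ^ (H - 1 / 2 - 1) * mesh T N) *
        |(node T N i : ℝ) - node T N (i - 1)| := by
    refine intervalIntegral.norm_integral_le_of_norm_le_const fun s hs => ?_
    rw [Set.uIoc_of_le hle] at hs
    refine (abs_rpow_sub_rpow_le (abs_half_sub_le hH0 hH1) (by linarith) hx hv1 hs.1.le).trans ?_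
    gcongr
    rw [abs_le]
    constructor <;> linarith [hs.1, hs.2]
  rw [hlen, abs_of_pos hm] at hb
  rw [e, abs_mul, abs_of_pos (inv_pos.2 hm), inv_mul_le_iff₀ hm, mul_comm]
  exact hb

/-- The constant is `2^(3/2 - H)`, rounded up to `2^2`. -/
lemma two_rpow_le (hH0 : 0 < H) {x v : ℝ} (hx : 0 < x) (hv : v ≤ 2 * x) (hxv : x ≤ v)
    (hH1 : H < 1) : x ^ (H - 1 / 2 - 1) ≤ 4 * v ^ (H - 1 / 2 - 1) := by
  have hvp : 0 < v := hx.trans_le hxv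
  calc x ^ (H - 1 / 2 - 1) ≤ (v / 2) ^ (H - 1 / 2 - 1) :=
        Real.rpow_le_rpow_of_nonpos (by positivity) (by linarith) (by linarith)
    _ = 2 ^ (-(H - 1 / 2 - 1)) * v ^ (H - 1 / 2 - 1) := by
        rw [Real.div_rpow hvp.le (by norm_num), Real.rpow_neg (by norm_num)]
        field_simp
    _ ≤ 2 ^ (2 : ℝ) * v ^ (H - 1 / 2 - 1) := by
        gcongr
        · norm_num
        · linarith
    _ = _ := by norm_num

/-- To the right of `t_{k-1}` the kernels coincide, which is the purpose of treating that cell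
exactly. In a cell further left, `v = t_k - u` lies in `[t_{i-1}, t_i]` with `i ≥ 2`. Then `t_i ≤ 2
t_{i-1}`, so the error `Δ t_{i-1}^(ζ-1)` from averaging is at most `4 Δ v^(ζ-1)`, the tail of
`domKernel`. Excluding the node `t_{k-1}` makes `v > Δ` strict there. -/
lemma abs_powerKernel_sub_nodeKernel_le (hH0 : 0 < H) (hH1 : H < 1) (hm : 0 < mesh T N) {k : ℕ}
    (hk : 1 ≤ k) : ∀ᵐ u ∂halfLine,
      |powerKernel (H - 1 / 2) 0 (node T N k) u - nodeKernel H T N k u| ≤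
        4 * domKernel (H - 1 / 2) (mesh T N) (node T N k - u) := by
  have hne0 : ∀ᵐ u ∂halfLine, u ≠ (0 : ℝ) := ae_restrict_of_ae (Measure.ae_ne volume _)
  have hne1 : ∀ᵐ u ∂halfLine, u ≠ (node T N (k - 1) : ℝ) :=
    ae_restrict_of_ae (Measure.ae_ne volume _)
  filter_upwards [hne0, hne1, ae_restrict_mem measurableSet_Ici] with u hu0 hu1 hu
  have hu : 0 < u := lt_of_le_of_ne hu hu0.symm
  have hm' : (0 : ℝ) < mesh T N := hm
  have hD := domKernel_nonneg (ζ := H - 1 / 2) hm'.le (node T N k - u)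
  have hk1 : ((k - 1 : ℕ) : ℝ) = k - 1 := by rw [Nat.cast_sub hk]; simp
  have hnk : (node T N (k - 1) : ℝ) = node T N k - mesh T N := by
    rw [coe_node, coe_node, hk1]; ring
  set j := ⌈u / mesh T N⌉₊ with hj
  have hj1 : 1 ≤ j := Nat.one_le_iff_ne_zero.2 (by
    rw [hj, Ne, Nat.ceil_eq_zero, not_le]; positivity)
  have hind : ∀ m, (Set.Ioc (node T N m : ℝ) (node T N (m + 1))).indicator (fun _ => (1 : ℝ)) u =
      if j = m + 1 then 1 else 0 := by
    intro m
    rw [Set.indicator_apply]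
    simp only [mem_Ioc_node_iff hm, hj]
  have hju := (mem_Ioc_node_iff hm (u := u) (j - 1)).2 (by omega)
  rw [show j - 1 + 1 = j by omega] at hju
  have hjc : ((j - 1 : ℕ) : ℝ) = j - 1 := by rw [Nat.cast_sub hj1]; simp
  rw [coe_node, coe_node, hjc] at hju
  simp only [nodeKernel, hind]
  rcases lt_or_gt_of_ne hu1 with hlt | hgt
  swap
  · have hs : ∀ i ∈ Finset.Icc 2 k, weight H T N i * (if j = k - i + 1 then (1 : ℝ) else 0) = 0 := by
      intro i hi
      rw [Finset.mem_Icc] at hi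
      rw [if_neg, mul_zero]
      intro h
      have h2 : (j : ℝ) ≤ k - 1 := by
        have : j + 1 ≤ k := by omega
        have : (j : ℝ) + 1 ≤ k := by exact_mod_cast this
        linarith
      have h3 : (j : ℝ) * mesh T N ≤ (k - 1) * mesh T N := by gcongr
      rw [hnk, coe_node] at hgt
      linarith [hju.2]
    rw [Finset.sum_eq_zero hs]
    have e : powerKernel (H - 1 / 2) 0 (node T N k) u =
        powerKernel (H - 1 / 2) (node T N (k - 1)) (node T N k) u := by
      simp [powerKernel, Set.indicator_apply, hu, hgt]
    rw [e]
    simpa using hD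
  have hjk : j + 1 ≤ k := by
    by_contra hcon
    have h2 : (k : ℝ) ≤ j := by exact_mod_cast (by omega : k ≤ j)
    rw [hnk, coe_node] at hlt
    have h3 : (k : ℝ) * mesh T N ≤ j * mesh T N := by gcongr
    linarith [hju.1]
  have hjk' : (j : ℝ) + 1 ≤ k := by exact_mod_cast hjk
  have e0 : powerKernel (H - 1 / 2) (node T N (k - 1)) (node T N k) u = 0 := by
    simp [powerKernel, hlt.not_gt]
  have huk : u < node T N k := by linarith
  have e1 : powerKernel (H - 1 / 2) 0 (node T N k) u = (node T N k - u) ^ (H - 1 / 2) := by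
    simp [powerKernel, hu, huk.le]
  -- The point `u` lies in the `j`-th cell, and the summand living on that cell has `k - i + 1 = j`.
  rw [Finset.sum_eq_single (k - j + 1), if_pos (by omega), mul_one, e0, e1, zero_add]
  · have hn1 : (node T N (k - j + 1 - 1) : ℝ) = (k - j) * mesh T N := by
      rw [coe_node]; congr 1
      rw [show k - j + 1 - 1 = k - j by omega, Nat.cast_sub (by omega)]
    have hn2 : (node T N (k - j + 1) : ℝ) = (k - j + 1) * mesh T N := by
      rw [coe_node]; congr 1
      push_cast [Nat.cast_sub (by omega : j ≤ k)]; ring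
    have hx1 : (mesh T N : ℝ) ≤ (k - j) * mesh T N := by nlinarith
    have hv1 : ((k : ℝ) - j) * mesh T N ≤ node T N k - u := by
      rw [coe_node]; linarith [hju.2]
    have hv2 : node T N k - u ≤ ((k : ℝ) - j + 1) * mesh T N := by
      rw [coe_node]; linarith [hju.1]
    refine (abs_weight_sub_le hH0 hH1 hm (by omega) (by rw [hn1]; exact hv1)
      (by rw [hn2]; exact hv2)).trans ?_
    rw [domKernel_of_lt (by linarith), hn1, mul_comm, ← mul_assoc, mul_comm 4, mul_assoc]
    gcongr
    exact two_rpow_le hH0 (by linarith) (by linarith) hv1 hH1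
  · intro i hi hne
    rw [Finset.mem_Icc] at hi
    rw [if_neg (by omega), mul_zero]
  · intro h
    exact absurd (Finset.mem_Icc.2 ⟨by omega, by omega⟩) h

lemma eLpNorm_powerKernel_sub_nodeKernel_le (hH0 : 0 < H) (hH1 : H < 1) (hm : 0 < mesh T N) {k : ℕ}
    (hk : 1 ≤ k) :
    eLpNorm (fun u => powerKernel (H - 1 / 2) 0 (node T N k) u - nodeKernel H T N k u) 2 halfLine ≤
      ENNReal.ofReal (4 * domConst H * (mesh T N : ℝ) ^ H) := by
  have hm' : (0 : ℝ) < mesh T N := hm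
  refine (eLpNorm_mono_ae_real (abs_powerKernel_sub_nodeKernel_le hH0 hH1 hm hk)).trans ?_
  have e : (fun u : ℝ => 4 * domKernel (H - 1 / 2) (mesh T N) (node T N k - u)) =
      (4 : ℝ) • fun u : ℝ => domKernel (H - 1 / 2) (mesh T N) (node T N k - u) := rfl
  rw [e, eLpNorm_const_smul, mul_assoc, ENNReal.ofReal_mul (by norm_num),
    Real.enorm_eq_ofReal (by norm_num)]
  gcongr
  exact eLpNorm_domKernel_sub_le hH0 hH1 hm' _

end

section

variable {Ω : Type*} [MeasurableSpace Ω]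

/-! ### Bounds in `L^p` -/

/-- `f` is a random variable with `L^p` norm at most the nonnegative real number `r`. -/
structure LpBound (P : Measure Ω) (p : ℝ≥0∞) (f : Ω → ℝ) (r : ℝ) : Prop where
  aestronglyMeasurable : AEStronglyMeasurable f P
  nonneg : 0 ≤ r
  le : eLpNorm f p P ≤ ENNReal.ofReal r

namespace LpBound

variable {P : Measure Ω} {p : ℝ≥0∞} {f g : Ω → ℝ} {r r' : ℝ}

lemma mono (hf : LpBound P p f r) (h : r ≤ r') : LpBound P p f r' :=
  ⟨hf.1, hf.2.trans h, hf.3.trans (ENNReal.ofReal_le_ofReal h)⟩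

lemma congr (hf : LpBound P p f r) (h : f =ᵐ[P] g) : LpBound P p g r :=
  ⟨hf.1.congr h, hf.2, (eLpNorm_congr_ae h).symm.le.trans hf.3⟩

lemma zero : LpBound P p (fun _ => 0) 0 := ⟨aestronglyMeasurable_const, le_rfl, by simp⟩

lemma add (hp : 1 ≤ p) (hf : LpBound P p f r) (hg : LpBound P p g r') :
    LpBound P p (fun ω => f ω + g ω) (r + r') := by
  refine ⟨hf.1.add hg.1, add_nonneg hf.2 hg.2, (eLpNorm_add_le hf.1 hg.1 hp).trans ?_⟩
  rw [ENNReal.ofReal_add hf.2 hg.2]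
  exact add_le_add hf.3 hg.3

lemma const_mul (hf : LpBound P p f r) (a : ℝ) : LpBound P p (fun ω => a * f ω) (|a| * r) := by
  refine ⟨hf.1.const_mul a, mul_nonneg (abs_nonneg _) hf.2, ?_⟩
  refine (eLpNorm_const_smul a f p P).le.trans ?_
  rw [ENNReal.ofReal_mul (abs_nonneg _), Real.enorm_eq_ofReal_abs]
  gcongr
  exact hf.3

lemma sub (hp : 1 ≤ p) (hf : LpBound P p f r) (hg : LpBound P p g r') :
    LpBound P p (fun ω => f ω - g ω) (r + r') := by
  have h := hf.add hp (hg.const_mul (-1))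
  simp only [abs_neg, abs_one, one_mul, neg_mul] at h
  exact h

lemma sum (hp : 1 ≤ p) {ι : Type*} (A : Finset ι) {F : ι → Ω → ℝ} {R : ι → ℝ}
    (h : ∀ i ∈ A, LpBound P p (F i) (R i)) :
    LpBound P p (fun ω => ∑ i ∈ A, F i ω) (∑ i ∈ A, R i) := by
  classical
  induction A using Finset.induction_on with
  | empty => simpa using zero
  | insert a A ha ih =>
    simp only [Finset.sum_insert ha]
    exact (h a (by simp)).add hp (ih fun i hi => h i (by simp [hi]))

end LpBound

variable {P : Measure Ω} {W X : ℝ≥0 → Ω → ℝ} {H : ℝ} {T : ℝ≥0} {N : ℕ} {p : ℝ≥0∞}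

lemma IsWienerIntegral.lpBound (hW : IsPreBrownianReal W P) {f : ℝ → ℝ} {I : Ω → ℝ}
    (h : IsWienerIntegral W P f I) (hp : p ≠ ∞) {r : ℝ} (hr : 0 ≤ r)
    (hf : eLpNorm f 2 halfLine ≤ ENNReal.ofReal r) :
    LpBound P p I ((gaussianMoment p).toReal * r) := by
  refine ⟨h.2.1.1, by positivity, (h.eLpNorm_le hW p hp).trans ?_⟩
  rw [ENNReal.ofReal_mul ENNReal.toReal_nonneg, ENNReal.ofReal_toReal (gaussianMoment_ne_top hp)]
  gcongr

/-- The constant in the `L^p` estimates for the Riemann–Liouville process and its hybrid scheme. -/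
def scaleConst (H : ℝ) (p : ℝ≥0∞) : ℝ :=
  √(2 * (H - 1 / 2) + 1) * ((gaussianMoment p).toReal * (4 * domConst H))

lemma scaleConst_nonneg (H : ℝ) (p : ℝ≥0∞) : 0 ≤ scaleConst H p := by
  unfold scaleConst domConst
  positivity

/-- The kernel estimate has constant `3`; it is relaxed to the `4` in `scaleConst` so that one
constant serves both increments and node errors. -/
lemma lpBound_sub_of_lt (hW : IsPreBrownianReal W P) (hH0 : 0 < H) (hH1 : H < 1)
    (hX : IsRiemannLiouvilleFBM H W P X) (hp : p ≠ ∞) {s t : ℝ≥0} (hst : s < t) :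
    LpBound P p (fun ω => X t ω - X s ω) (scaleConst H p * (t - s : ℝ) ^ H) := by
  have hh : (0 : ℝ) < t - s := sub_pos.2 hst
  have hD : 0 ≤ domConst H := Real.sqrt_nonneg _
  have h := ((isWienerIntegral_wienerIntegral hW (memLp_powerKernel hH0 hH1 0 t)).sub hW
    (isWienerIntegral_wienerIntegral hW (memLp_powerKernel hH0 hH1 0 s))).lpBound hW hp
    (by positivity) (eLpNorm_powerKernel_sub_le hH0 hH1 hst)
  refine ((h.const_mul √(2 * (H - 1 / 2) + 1)).congr ?_).mono ?_
  · filter_upwards [hX.ae_eq_integral s, hX.ae_eq_integral t] with ω h1 h2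
    rw [h1, h2]; ring
  · rw [abs_of_nonneg (Real.sqrt_nonneg _), scaleConst, mul_assoc √_, mul_assoc (gaussianMoment p).toReal]
    gcongr
    norm_num

lemma lpBound_process_zero (hW : IsPreBrownianReal W P) (hH0 : 0 < H) (hH1 : H < 1)
    (hX : IsRiemannLiouvilleFBM H W P X) (hp : p ≠ ∞) : LpBound P p (X 0) 0 := by
  have h := (isWienerIntegral_wienerIntegral hW (memLp_powerKernel hH0 hH1 0 0)).lpBound hW hp
    le_rfl (by simp [powerKernel])
  have h' := (h.const_mul √(2 * (H - 1 / 2) + 1)).congr (hX.ae_eq_integral 0).symm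
  simpa using h'

lemma aestronglyMeasurable_process (hW : IsPreBrownianReal W P) (hH0 : 0 < H) (hH1 : H < 1)
    (hX : IsRiemannLiouvilleFBM H W P X) (t : ℝ≥0) : AEStronglyMeasurable (X t) P :=
  ((isWienerIntegral_wienerIntegral hW (memLp_powerKernel hH0 hH1 0 t)).2.1.1.const_mul _).congr
    (hX.ae_eq_integral t).symm

lemma ae_process_zero (hW : IsPreBrownianReal W P) (hH0 : 0 < H) (hH1 : H < 1)
    (hX : IsRiemannLiouvilleFBM H W P X) : ∀ᵐ ω ∂P, X 0 ω = 0 := by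
  have h := (lpBound_process_zero (p := 2) hW hH0 hH1 hX (by norm_num))
  have h2 := h.le
  rw [ENNReal.ofReal_zero, nonpos_iff_eq_zero, eLpNorm_eq_zero_iff h.1 (by norm_num)] at h2
  exact h2

lemma lpBound_sub (hW : IsPreBrownianReal W P) (hH0 : 0 < H) (hH1 : H < 1)
    (hX : IsRiemannLiouvilleFBM H W P X) (hp : p ≠ ∞) (s t : ℝ≥0) :
    LpBound P p (fun ω => X t ω - X s ω) (scaleConst H p * |(t - s : ℝ)| ^ H) := by
  rcases lt_trichotomy s t with h | rfl | h
  · have hst : (0 : ℝ) < t - s := sub_pos.2 h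
    rw [abs_of_pos hst]
    exact lpBound_sub_of_lt hW hH0 hH1 hX hp h
  · simpa [Real.zero_rpow hH0.ne'] using LpBound.zero (P := P) (p := p)
  · have hst : (0 : ℝ) < s - t := sub_pos.2 h
    rw [abs_sub_comm, abs_of_pos hst]
    have h1 := (lpBound_sub_of_lt hW hH0 hH1 hX hp h).const_mul (-1)
    simpa using h1

lemma isWienerIntegral_hybridAtNode (hW : IsPreBrownianReal W P) (hH0 : 0 < H) (hH1 : H < 1)
    {k : ℕ} (hk : 1 ≤ k) : IsWienerIntegral W P
      (fun u => √(2 * (H - 1 / 2) + 1) * nodeKernel H T N k u) (hybridAtNode H T W P N k) := by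
  have hs : IsWienerIntegral W P (fun u => ∑ i ∈ Finset.Icc 2 k, weight H T N i *
      (Set.Ioc (node T N (k - i) : ℝ) (node T N (k - i + 1))).indicator (fun _ => (1 : ℝ)) u)
      (fun ω => ∑ i ∈ Finset.Icc 2 k,
        weight H T N i * (W (node T N (k - i + 1)) ω - W (node T N (k - i)) ω)) :=
    IsWienerIntegral.sum hW _ fun i _ => (isWienerIntegral_increment hW (by
      unfold node; gcongr; simp)).const_mul _
  refine (((isWienerIntegral_wienerIntegral hW (memLp_powerKernel hH0 hH1
    (node T N (k - 1)) (node T N k))).add hW hs).const_mul √(2 * (H - 1 / 2) + 1)).congr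
    (.of_forall fun u => rfl) (.of_forall fun ω => ?_)
  simp only [hybridAtNode]
  rw [if_neg (by omega), mul_add]

lemma lpBound_hybridAtNode_sub (hW : IsPreBrownianReal W P) (hH0 : 0 < H) (hH1 : H < 1)
    (hX : IsRiemannLiouvilleFBM H W P X) (hp : p ≠ ∞) (hm : 0 < mesh T N) (k : ℕ) :
    LpBound P p (fun ω => hybridAtNode H T W P N k ω - X (node T N k) ω)
      (scaleConst H p * (mesh T N : ℝ) ^ H) := by
  have hm' : (0 : ℝ) < mesh T N := hm
  have hD : 0 ≤ domConst H := Real.sqrt_nonneg _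
  have hK := scaleConst_nonneg H p
  rcases Nat.eq_zero_or_pos k with rfl | hk
  · have h := ((lpBound_process_zero hW hH0 hH1 hX hp).const_mul (-1)).mono
      (r' := scaleConst H p * (mesh T N : ℝ) ^ H) (by simp; positivity)
    simpa [hybridAtNode, node] using h
  have h1 := (isWienerIntegral_wienerIntegral hW (memLp_powerKernel hH0 hH1 0 (node T N k))).const_mul
    √(2 * (H - 1 / 2) + 1)
  have h2 := isWienerIntegral_hybridAtNode (T := T) (N := N) hW hH0 hH1 hk
  have h3 := (h1.sub hW h2).lpBound hW hp (r := √(2 * (H - 1 / 2) + 1) *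
    (4 * domConst H * (mesh T N : ℝ) ^ H)) (by positivity) (by
      have e : (fun s => √(2 * (H - 1 / 2) + 1) * powerKernel (H - 1 / 2) 0 (node T N k) s -
          √(2 * (H - 1 / 2) + 1) * nodeKernel H T N k s) = √(2 * (H - 1 / 2) + 1) •
          fun s => (powerKernel (H - 1 / 2) 0 (node T N k) s - nodeKernel H T N k s) := by
        ext s; simp; ring
      rw [e, eLpNorm_const_smul, ENNReal.ofReal_mul (Real.sqrt_nonneg _),
        Real.enorm_eq_ofReal (Real.sqrt_nonneg _)]
      gcongr
      exact eLpNorm_powerKernel_sub_nodeKernel_le hH0 hH1 hm hk)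
  refine ((h3.const_mul (-1)).congr ?_).mono (le_of_eq ?_)
  · filter_upwards [hX.ae_eq_integral (node T N k)] with ω h
    rw [h]; ring
  · rw [abs_neg, abs_one, scaleConst]; ring

/-! ### Piecewise linear interpolation -/

/-- The ramp rising from `0` to `1` on `[k, k+1]`. -/
def ramp (k : ℕ) (x : ℝ) : ℝ := min x (k + 1) - min x k

lemma ramp_mono (k : ℕ) : Monotone (ramp k) := by
  intro x y hxy
  unfold ramp
  rcases le_total x k with h1 | h1 <;> rcases le_total y k with h2 | h2 <;>
    rcases le_total x (k + 1) with h3 | h3 <;> rcases le_total y (k + 1) with h4 | h4 <;>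
    simp only [min_eq_left, min_eq_right, h1, h2, h3, h4] <;> linarith

lemma sum_ramp {x : ℝ} (hx : 0 ≤ x) {M : ℕ} (hM : x ≤ M) : ∑ k ∈ Finset.range M, ramp k x = x := by
  have h := Finset.sum_range_sub (fun k : ℕ => min x (k : ℝ)) M
  simp only [Nat.cast_add, Nat.cast_one, Nat.cast_zero, min_eq_left hM, min_eq_right hx,
    sub_zero] at h
  exact h

/-- In this form the interpolant depends on `x` only through monotone ramps. Its increments are
therefore nonnegative combinations of node increments, with no case distinction on the cells
containing the end points. -/
lemma interpolation_eq_sum_ramp (a : ℕ → ℝ) {x : ℝ} {K M : ℕ} (h1 : (K : ℝ) ≤ x)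
    (h2 : x < K + 1) (hM : K + 1 ≤ M) :
    a K + (x - K) * (a (K + 1) - a K) =
      a 0 + ∑ k ∈ Finset.range M, ramp k x * (a (k + 1) - a k) := by
  induction M, hM using Nat.le_induction with
  | base =>
    rw [Finset.sum_range_succ]
    have e : ∑ k ∈ Finset.range K, ramp k x * (a (k + 1) - a k) =
        ∑ k ∈ Finset.range K, (a (k + 1) - a k) := by
      refine Finset.sum_congr rfl fun k hk => ?_
      have : (k : ℝ) + 1 ≤ K := by exact_mod_cast Finset.mem_range.1 hk
      rw [ramp, min_eq_right (by linarith), min_eq_right (by linarith)]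
      ring
    rw [e, Finset.sum_range_sub, ramp, min_eq_left h2.le, min_eq_right h1]
    ring
  | succ M hM ih =>
    have : (K : ℝ) + 1 ≤ M := by exact_mod_cast hM
    rw [Finset.sum_range_succ, ih, ramp, min_eq_left (by linarith), min_eq_left (by linarith)]
    ring

lemma hybrid_eq_sum_ramp (hm : 0 < mesh T N) (t : ℝ≥0) {M : ℕ} (hM : (t : ℝ) / mesh T N < M)
    (ω : Ω) : hybrid H T W P N t ω = hybridAtNode H T W P N 0 ω +
      ∑ k ∈ Finset.range M, ramp k (t / mesh T N) *
        (hybridAtNode H T W P N (k + 1) ω - hybridAtNode H T W P N k ω) := by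
  have hm' : (0 : ℝ) < mesh T N := hm
  have h1 : ((⌊(t / mesh T N : ℝ≥0)⌋₊ : ℕ) : ℝ) ≤ t / mesh T N := by
    have := Nat.floor_le (zero_le (a := (t / mesh T N : ℝ≥0)))
    exact_mod_cast this
  have h2 : (t : ℝ) / mesh T N < (⌊(t / mesh T N : ℝ≥0)⌋₊ : ℕ) + 1 := by
    have := Nat.lt_floor_add_one (t / mesh T N : ℝ≥0)
    exact_mod_cast this
  have h3 : ⌊(t / mesh T N : ℝ≥0)⌋₊ + 1 ≤ M := by
    have : ((⌊(t / mesh T N : ℝ≥0)⌋₊ : ℕ) : ℝ) < M := h1.trans_lt hM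
    exact_mod_cast this
  rw [← interpolation_eq_sum_ramp (fun k => hybridAtNode H T W P N k ω) h1 h2 h3]
  simp only [hybrid]
  rw [coe_node, sub_div, mul_div_cancel_right₀ _ hm'.ne']

lemma hybrid_node (hm : 0 < mesh T N) (k : ℕ) (ω : Ω) :
    hybrid H T W P N (node T N k) ω = hybridAtNode H T W P N k ω := by
  have h : (node T N k / mesh T N : ℝ≥0) = k := by
    rw [node, mul_div_cancel_right₀ _ hm.ne']
  simp [hybrid, h]

lemma continuous_hybrid (hm : 0 < mesh T N) (ω : Ω) :
    Continuous fun t => hybrid H T W P N t ω := by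
  rw [continuous_iff_continuousAt]
  intro t
  obtain ⟨M, hM⟩ := exists_nat_gt ((t : ℝ) / mesh T N)
  have hev : ∀ᶠ s : ℝ≥0 in 𝓝 t, (s : ℝ) / mesh T N < M :=
    (by fun_prop : Continuous fun s : ℝ≥0 => (s : ℝ) / mesh T N).continuousAt.eventually_lt
      continuousAt_const hM
  have hc : Continuous fun s : ℝ≥0 => hybridAtNode H T W P N 0 ω +
      ∑ k ∈ Finset.range M, ramp k (s / mesh T N) *
        (hybridAtNode H T W P N (k + 1) ω - hybridAtNode H T W P N k ω) := by
    unfold ramp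
    fun_prop
  refine hc.continuousAt.congr ?_
  filter_upwards [hev] with s hs using (hybrid_eq_sum_ramp hm s hs ω).symm

lemma hybrid_zero (hm : 0 < mesh T N) (ω : Ω) : hybrid H T W P N 0 ω = 0 := by
  have h := hybrid_node (H := H) (W := W) (P := P) hm 0 ω
  simpa [node, hybridAtNode] using h

lemma aestronglyMeasurable_hybridAtNode (hW : IsPreBrownianReal W P) (hH0 : 0 < H) (hH1 : H < 1)
    (k : ℕ) : AEStronglyMeasurable (hybridAtNode H T W P N k) P := by
  rcases Nat.eq_zero_or_pos k with rfl | hk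
  · exact aestronglyMeasurable_const (b := (0 : ℝ))
  · exact (isWienerIntegral_hybridAtNode hW hH0 hH1 hk).2.1.1

lemma aestronglyMeasurable_hybrid (hW : IsPreBrownianReal W P) (hH0 : 0 < H) (hH1 : H < 1)
    (t : ℝ≥0) : AEStronglyMeasurable (hybrid H T W P N t) P :=
  (aestronglyMeasurable_hybridAtNode hW hH0 hH1 _).add
    (((aestronglyMeasurable_hybridAtNode hW hH0 hH1 _).sub
      (aestronglyMeasurable_hybridAtNode hW hH0 hH1 _)).const_mul _)

/-- Two node errors and one increment of `X` over a cell make the factor `3`. -/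
lemma lpBound_hybridAtNode_succ_sub (hW : IsPreBrownianReal W P) (hH0 : 0 < H) (hH1 : H < 1)
    (hX : IsRiemannLiouvilleFBM H W P X) (hp1 : 1 ≤ p) (hp : p ≠ ∞) (hm : 0 < mesh T N) (k : ℕ) :
    LpBound P p (fun ω => hybridAtNode H T W P N (k + 1) ω - hybridAtNode H T W P N k ω)
      (3 * scaleConst H p * (mesh T N : ℝ) ^ H) := by
  have h := ((lpBound_hybridAtNode_sub hW hH0 hH1 hX hp hm (k + 1)).sub hp1
    (lpBound_hybridAtNode_sub hW hH0 hH1 hX hp hm k)).add hp1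
    (lpBound_sub hW hH0 hH1 hX hp (node T N k) (node T N (k + 1)))
  refine (h.congr (.of_forall fun ω => by ring)).mono (le_of_eq ?_)
  have e : (node T N (k + 1) : ℝ) - node T N k = mesh T N := by
    rw [coe_node, coe_node]; push_cast; ring
  rw [e, abs_of_pos (show (0 : ℝ) < mesh T N from hm)]
  ring

/-- The ramps sum to the identity, so the nonnegative weights on the node increments add up to `(t -
s) / Δ`. -/
lemma lpBound_hybrid_sub (hW : IsPreBrownianReal W P) (hH0 : 0 < H) (hH1 : H < 1)
    (hX : IsRiemannLiouvilleFBM H W P X) (hp1 : 1 ≤ p) (hp : p ≠ ∞) (hm : 0 < mesh T N)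
    {s t : ℝ≥0} (hst : s ≤ t) :
    LpBound P p (fun ω => hybrid H T W P N t ω - hybrid H T W P N s ω)
      (3 * scaleConst H p * (mesh T N : ℝ) ^ H * ((t - s) / mesh T N)) := by
  have hm' : (0 : ℝ) < mesh T N := hm
  obtain ⟨M, hM⟩ := exists_nat_gt ((t : ℝ) / mesh T N)
  have hst' : (s : ℝ) / mesh T N ≤ t / mesh T N := by gcongr
  have hMs : (s : ℝ) / mesh T N < M := hst'.trans_lt hM
  have h := LpBound.sum hp1 (Finset.range M) fun k _ =>
    (lpBound_hybridAtNode_succ_sub hW hH0 hH1 hX hp1 hp hm k).const_mul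
      (ramp k (t / mesh T N) - ramp k (s / mesh T N))
  refine (h.congr (.of_forall fun ω => ?_)).mono (le_of_eq ?_)
  · rw [hybrid_eq_sum_ramp hm t hM, hybrid_eq_sum_ramp hm s hMs, add_sub_add_left_eq_sub,
      ← Finset.sum_sub_distrib]
    exact Finset.sum_congr rfl fun k _ => by ring
  · rw [← Finset.sum_mul, Finset.sum_congr rfl fun k _ =>
      abs_of_nonneg (sub_nonneg.2 (ramp_mono k hst')), Finset.sum_sub_distrib,
      sum_ramp (by positivity) hM.le, sum_ramp (by positivity) hMs.le, sub_div]
    ring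

/-! ### The error process -/

/-- Compare at the node below `t`: the move of the scheme costs `3`, the node error `1` and the move
of `X` another `1`. -/
lemma lpBound_error (hW : IsPreBrownianReal W P) (hH0 : 0 < H) (hH1 : H < 1)
    (hX : IsRiemannLiouvilleFBM H W P X) (hp1 : 1 ≤ p) (hp : p ≠ ∞) (hm : 0 < mesh T N) (t : ℝ≥0) :
    LpBound P p (fun ω => hybrid H T W P N t ω - X t ω)
      (5 * scaleConst H p * (mesh T N : ℝ) ^ H) := by
  have hm' : (0 : ℝ) < mesh T N := hm
  have hK := scaleConst_nonneg H p
  set k := ⌊(t / mesh T N : ℝ≥0)⌋₊ with hk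
  have h1 : node T N k ≤ t := by
    have := Nat.floor_le (zero_le (a := (t / mesh T N : ℝ≥0)))
    rwa [le_div_iff₀ hm] at this
  have h1' : (node T N k : ℝ) ≤ t := h1
  have h2 : (t : ℝ) - node T N k ≤ mesh T N := by
    have := Nat.lt_floor_add_one (t / mesh T N : ℝ≥0)
    rw [div_lt_iff₀ hm, add_mul, one_mul] at this
    have : (t : ℝ) < k * mesh T N + mesh T N := by exact_mod_cast this
    rw [coe_node]; linarith
  have h := ((lpBound_hybrid_sub hW hH0 hH1 hX hp1 hp hm h1).add hp1
    (lpBound_hybridAtNode_sub hW hH0 hH1 hX hp hm k)).sub hp1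
    (lpBound_sub hW hH0 hH1 hX hp (node T N k) t)
  refine (h.congr (.of_forall fun ω => ?_)).mono ?_
  · simp only [hybrid_node hm]; ring
  · have e1 : ((t : ℝ) - node T N k) / mesh T N ≤ 1 := (div_le_one hm').2 h2
    have e2 : |(t : ℝ) - node T N k| ^ H ≤ (mesh T N : ℝ) ^ H := by
      gcongr
      rwa [abs_of_nonneg (by linarith)]
    calc _ ≤ 3 * scaleConst H p * (mesh T N : ℝ) ^ H * 1 + scaleConst H p * (mesh T N : ℝ) ^ H +
          scaleConst H p * (mesh T N : ℝ) ^ H := by gcongr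
      _ = _ := by ring

/-- Increments of the error process: Hölder regularity `β` can be traded for a rate `H - β`. -/
lemma lpBound_error_sub (hW : IsPreBrownianReal W P) (hH0 : 0 < H) (hH1 : H < 1)
    (hX : IsRiemannLiouvilleFBM H W P X) (hp1 : 1 ≤ p) (hp : p ≠ ∞) (hm : 0 < mesh T N)
    {β : ℝ} (hβ0 : 0 < β) (hβH : β < H) {s t : ℝ≥0} (hst : s < t) :
    LpBound P p (fun ω => (hybrid H T W P N t ω - X t ω) - (hybrid H T W P N s ω - X s ω))
      (10 * scaleConst H p * (mesh T N : ℝ) ^ (H - β) * (t - s : ℝ) ^ β) := by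
  have hm' : (0 : ℝ) < mesh T N := hm
  have hK := scaleConst_nonneg H p
  have hh : (0 : ℝ) < t - s := sub_pos.2 hst
  have hsplit : (mesh T N : ℝ) ^ H = (mesh T N : ℝ) ^ (H - β) * (mesh T N : ℝ) ^ β := by
    rw [← Real.rpow_add hm']; congr 1; ring
  -- For `Δ ≤ t - s` the uniform error at both end points suffices (`5 + 5`), since `Δ^β ≤ (t-s)^β`.
  -- For `t - s ≤ Δ` the increments of the scheme and of `X` are bounded separately (`3 + 1`).
  rcases le_total (mesh T N : ℝ) (t - s) with h | h
  · refine ((lpBound_error hW hH0 hH1 hX hp1 hp hm t).sub hp1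
      (lpBound_error hW hH0 hH1 hX hp1 hp hm s)).mono ?_
    have : (mesh T N : ℝ) ^ β ≤ (t - s : ℝ) ^ β := by gcongr
    calc _ = 10 * scaleConst H p * (mesh T N : ℝ) ^ (H - β) * (mesh T N : ℝ) ^ β := by
          rw [mul_assoc _ ((mesh T N : ℝ) ^ (H - β)), ← hsplit]; ring
      _ ≤ _ := by gcongr
  · refine (((lpBound_hybrid_sub hW hH0 hH1 hX hp1 hp hm hst.le).sub hp1
      (lpBound_sub hW hH0 hH1 hX hp s t)).congr (.of_forall fun ω => by ring)).mono ?_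
    rw [abs_of_pos hh]
    have e1 : (t - s : ℝ) ^ H ≤ (mesh T N : ℝ) ^ (H - β) * (t - s : ℝ) ^ β := by
      have : (t - s : ℝ) ^ H = (t - s : ℝ) ^ (H - β) * (t - s : ℝ) ^ β := by
        rw [← Real.rpow_add hh]; congr 1; ring
      rw [this]
      gcongr
    have e2 : (mesh T N : ℝ) ^ H * ((t - s) / mesh T N) ≤
        (mesh T N : ℝ) ^ (H - β) * (t - s : ℝ) ^ β := by
      rw [hsplit, mul_assoc]
      gcongr
      have hx0 : 0 < ((t : ℝ) - s) / mesh T N := by positivity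
      have hx1 : ((t : ℝ) - s) / mesh T N ≤ 1 := (div_le_one hm').2 h
      -- The Lipschitz factor `x ≤ 1` is weakened to `x^β`, which is allowed because `β < H < 1`.
      have h3 : ((t : ℝ) - s) / mesh T N ≤ (((t : ℝ) - s) / mesh T N) ^ β := by
        conv_lhs => rw [← Real.rpow_one (((t : ℝ) - s) / mesh T N)]
        exact Real.rpow_le_rpow_of_exponent_ge hx0 hx1 (by linarith)
      calc (mesh T N : ℝ) ^ β * (((t : ℝ) - s) / mesh T N)
          ≤ (mesh T N : ℝ) ^ β * (((t : ℝ) - s) / mesh T N) ^ β := by gcongr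
        _ = (t - s : ℝ) ^ β := by
          rw [← Real.mul_rpow hm'.le hx0.le, mul_div_cancel₀ _ hm'.ne']
    calc _ = 3 * scaleConst H p * ((mesh T N : ℝ) ^ H * ((t - s) / mesh T N)) +
          scaleConst H p * (t - s : ℝ) ^ H := by ring
      _ ≤ 3 * scaleConst H p * ((mesh T N : ℝ) ^ (H - β) * (t - s : ℝ) ^ β) +
          scaleConst H p * ((mesh T N : ℝ) ^ (H - β) * (t - s : ℝ) ^ β) := by gcongr
      _ = 4 * (scaleConst H p * ((mesh T N : ℝ) ^ (H - β) * (t - s : ℝ) ^ β)) := by ring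
      _ ≤ 10 * (scaleConst H p * ((mesh T N : ℝ) ^ (H - β) * (t - s : ℝ) ^ β)) := by
        gcongr; norm_num
      _ = _ := by ring

end

section

/-! ### Hölder bounds from dyadic increments -/

/-- The dyadic point `j 2⁻ˡ T`. -/
def dyadic (T : ℝ≥0) (l j : ℕ) : ℝ≥0 := T * (j / 2 ^ l)

lemma coe_dyadic (T : ℝ≥0) (l j : ℕ) : (dyadic T l j : ℝ) = T * (j / 2 ^ l) := by
  simp [dyadic]

lemma dyadic_succ_two_mul (T : ℝ≥0) (l j : ℕ) : dyadic T (l + 1) (2 * j) = dyadic T l j := by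
  unfold dyadic
  rw [pow_succ']
  push_cast
  rw [mul_div_mul_left _ _ two_ne_zero]

variable {T : ℝ≥0} {f : ℝ≥0 → ℝ} {B q : ℝ}

/-- Refining the dyadic floor of a point by one level either keeps it or moves it to its right
neighbour on the finer level. -/
lemma abs_sub_dyadic_floor_le (hq0 : 0 ≤ q) (hq1 : q ≤ 1) (hB : 0 ≤ B)
    (h : ∀ l j, j < 2 ^ l → |f (dyadic T l (j + 1)) - f (dyadic T l j)| ≤ B * q ^ l)
    {x : ℝ} (hx0 : 0 ≤ x) (hx1 : x ≤ 1) (m : ℕ) :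
    |f (dyadic T m ⌊x * 2 ^ m⌋₊) - f (dyadic T (m + 1) ⌊x * 2 ^ (m + 1)⌋₊)| ≤ B * q ^ m := by
  set j := ⌊x * 2 ^ m⌋₊ with hj
  have hx0' : 0 ≤ x * 2 ^ m := by positivity
  have h1 : (j : ℝ) ≤ x * 2 ^ m := Nat.floor_le hx0'
  have h2 : x * 2 ^ m < j + 1 := Nat.lt_floor_add_one _
  have hpow : x * 2 ^ (m + 1) = 2 * (x * 2 ^ m) := by rw [pow_succ]; ring
  have hq : B * q ^ (m + 1) ≤ B * q ^ m :=
    mul_le_mul_of_nonneg_left (pow_le_pow_of_le_one hq0 hq1 (Nat.le_succ m)) hB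
  have hcases : ⌊x * 2 ^ (m + 1)⌋₊ = 2 * j ∨ ⌊x * 2 ^ (m + 1)⌋₊ = 2 * j + 1 := by
    have h3 : 2 * j ≤ ⌊x * 2 ^ (m + 1)⌋₊ := by
      rw [Nat.le_floor_iff (by positivity), hpow]; push_cast; linarith
    have h4 : ⌊x * 2 ^ (m + 1)⌋₊ < 2 * j + 2 := by
      rw [Nat.floor_lt (by positivity), hpow]; push_cast; linarith
    omega
  rw [← dyadic_succ_two_mul T m j]
  rcases hcases with h5 | h5
  · rw [h5, sub_self, abs_zero]; positivity
  · rw [h5, abs_sub_comm]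
    refine (h (m + 1) (2 * j) ?_).trans hq
    have h6 : 2 * j + 1 ≤ 2 ^ (m + 1) := by
      rw [← h5]
      refine Nat.floor_le_of_le ?_
      push_cast
      calc x * 2 ^ (m + 1) ≤ 1 * 2 ^ (m + 1) := by gcongr
        _ = _ := one_mul _
    omega

/-- The dyadic floors converge to `t`, so continuity allows the one-level steps to be summed as a
geometric series. -/
lemma abs_sub_dyadic_floor_le' (hq0 : 0 ≤ q) (hq1 : q < 1) (hB : 0 ≤ B) (hT : 0 < T)
    (hf : Continuous f)
    (h : ∀ l j, j < 2 ^ l → |f (dyadic T l (j + 1)) - f (dyadic T l j)| ≤ B * q ^ l)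
    {t : ℝ≥0} (ht : t ≤ T) (m : ℕ) :
    |f (dyadic T m ⌊(t / T : ℝ) * 2 ^ m⌋₊) - f t| ≤ B * q ^ m / (1 - q) := by
  have hT' : (0 : ℝ) < T := hT
  have ht' : (t : ℝ) ≤ T := ht
  refine dist_le_of_le_geometric_of_tendsto (f := fun m => f (dyadic T m ⌊(t / T : ℝ) * 2 ^ m⌋₊))
    q B hq1 (fun n => ?_) ?_ m
  · exact abs_sub_dyadic_floor_le hq0 hq1.le hB h (by positivity) ((div_le_one hT').2 ht') n
  · refine (hf.tendsto t).comp ?_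
    rw [← NNReal.tendsto_coe]
    simp only [coe_dyadic]
    have h1 := (tendsto_nat_floor_mul_div_atTop (R := ℝ) (a := t / T) (by positivity)).comp
      (tendsto_pow_atTop_atTop_of_one_lt (one_lt_two (α := ℝ)))
    have h2 := h1.const_mul (T : ℝ)
    rwa [mul_div_cancel₀ _ hT'.ne'] at h2

lemma abs_sub_le_of_dyadic (hq0 : 0 ≤ q) (hq1 : q < 1) (hB : 0 ≤ B) (hT : 0 < T)
    (hf : Continuous f)
    (h : ∀ l j, j < 2 ^ l → |f (dyadic T l (j + 1)) - f (dyadic T l j)| ≤ B * q ^ l)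
    {s t : ℝ≥0} (hst : s < t) (ht : t ≤ T) :
    ∃ m : ℕ, (1 / 2 : ℝ) ^ (m + 1) < (t - s) / T ∧ |f t - f s| ≤ 3 / (1 - q) * B * q ^ m := by
  have hT' : (0 : ℝ) < T := hT
  have ht' : (t : ℝ) ≤ T := ht
  have hst' : (0 : ℝ) < t - s := sub_pos.2 hst
  have hs0 : (0 : ℝ) ≤ s := s.2
  -- Level `m` satisfies `2^(-(m+1)) < (t-s)/T ≤ 2^(-m)`. The floors of `s` and `t` at this level
  -- are thus equal or adjacent, and the path through them has three pieces, each at most `B q^m /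
  -- (1-q)`.
  obtain ⟨m, hm1, hm2⟩ := exists_nat_pow_near_of_lt_one (x := ((t : ℝ) - s) / T) (y := 1 / 2)
    (by positivity) ((div_le_one hT').2 (by linarith)) (by norm_num) (by norm_num)
  refine ⟨m, hm1, ?_⟩
  have ht1 := abs_sub_dyadic_floor_le' hq0 hq1 hB hT hf h ht m
  have hs1 := abs_sub_dyadic_floor_le' hq0 hq1 hB hT hf h (hst.le.trans ht) m
  set j := ⌊(s / T : ℝ) * 2 ^ m⌋₊ with hj
  set i := ⌊(t / T : ℝ) * 2 ^ m⌋₊ with hi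
  have hij : j ≤ i := Nat.floor_mono (by gcongr)
  have hji : i < j + 2 := by
    rw [hi, Nat.floor_lt (by positivity)]
    have h1 : (s / T : ℝ) * 2 ^ m < j + 1 := Nat.lt_floor_add_one _
    have h2 : ((t : ℝ) - s) / T * 2 ^ m ≤ 1 := by
      calc ((t : ℝ) - s) / T * 2 ^ m ≤ (1 / 2) ^ m * 2 ^ m := by gcongr
        _ = 1 := by rw [← mul_pow]; norm_num
    rw [sub_div, sub_mul] at h2
    push_cast
    linarith
  have hmid : |f (dyadic T m i) - f (dyadic T m j)| ≤ B * q ^ m / (1 - q) := by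
    have hle : B * q ^ m ≤ B * q ^ m / (1 - q) := by
      rw [le_div_iff₀ (by linarith)]
      exact mul_le_of_le_one_right (by positivity) (by linarith)
    rcases (by omega : i = j ∨ i = j + 1) with h1 | h1
    · rw [h1, sub_self, abs_zero]
      exact le_trans (by positivity) hle
    · rw [h1]
      refine (h m j ?_).trans hle
      have : i ≤ 2 ^ m := by
        refine Nat.floor_le_of_le ?_
        push_cast
        calc (t / T : ℝ) * 2 ^ m ≤ 1 * 2 ^ m := by
              gcongr; exact (div_le_one hT').2 ht'
          _ = _ := one_mul _
      omega
  have e : f t - f s = -(f (dyadic T m i) - f t) + (f (dyadic T m i) - f (dyadic T m j)) +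
      (f (dyadic T m j) - f s) := by ring
  rw [e]
  calc _ ≤ |f (dyadic T m i) - f t| + |f (dyadic T m i) - f (dyadic T m j)| +
        |f (dyadic T m j) - f s| := by
        refine (abs_add_le _ _).trans (add_le_add ((abs_add_le _ _).trans ?_) le_rfl)
        rw [abs_neg]
    _ ≤ B * q ^ m / (1 - q) + B * q ^ m / (1 - q) + B * q ^ m / (1 - q) := by gcongr
    _ = _ := by ring

/-- The constant in the Hölder bound `abs_sub_le_holderConst_mul`. -/
def holderConst (γ : ℝ) (T : ℝ≥0) : ℝ := 3 / (1 - 2 ^ (-γ)) * 2 ^ γ / (T : ℝ) ^ γ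

lemma two_rpow_neg_lt_one {γ : ℝ} (hγ : 0 < γ) : (2 : ℝ) ^ (-γ) < 1 :=
  Real.rpow_lt_one_of_one_lt_of_neg one_lt_two (by linarith)

lemma holderConst_pos {γ : ℝ} (hγ : 0 < γ) (hT : 0 < T) : 0 < holderConst γ T := by
  have hT' : (0 : ℝ) < T := hT
  have : 0 < 1 - (2 : ℝ) ^ (-γ) := sub_pos.2 (two_rpow_neg_lt_one hγ)
  unfold holderConst
  positivity

lemma abs_sub_le_holderConst_mul {γ : ℝ} (hγ : 0 < γ) (hB : 0 ≤ B) (hT : 0 < T)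
    (hf : Continuous f) (h : ∀ l j, j < 2 ^ l →
      |f (dyadic T l (j + 1)) - f (dyadic T l j)| ≤ B * ((2 : ℝ) ^ (-γ)) ^ l)
    {s t : ℝ≥0} (hst : s < t) (ht : t ≤ T) :
    |f t - f s| ≤ holderConst γ T * B * (t - s : ℝ) ^ γ := by
  have hT' : (0 : ℝ) < T := hT
  have hst' : (0 : ℝ) < t - s := sub_pos.2 hst
  have hq1 : 0 < 1 - (2 : ℝ) ^ (-γ) := sub_pos.2 (two_rpow_neg_lt_one hγ)
  obtain ⟨m, hm, hle⟩ := abs_sub_le_of_dyadic (by positivity) (two_rpow_neg_lt_one hγ) hB hT hf h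
    hst ht
  refine hle.trans ?_
  -- The lower bound on `t - s` is at level `m + 1`; the shift by one level costs the factor `2^γ`
  -- in `holderConst`.
  have h1 : ((2 : ℝ) ^ (-γ)) ^ m = 2 ^ γ * ((1 / 2 : ℝ) ^ (m + 1)) ^ γ := by
    rw [one_div, inv_pow, Real.inv_rpow (by positivity), ← Real.rpow_natCast,
      ← Real.rpow_natCast, ← Real.rpow_mul (by norm_num), ← Real.rpow_mul (by norm_num),
      ← Real.rpow_neg (by norm_num), ← Real.rpow_add (by norm_num)]
    congr 1; push_cast; ring
  rw [h1]
  calc _ ≤ 3 / (1 - 2 ^ (-γ)) * B * (2 ^ γ * (((t : ℝ) - s) / T) ^ γ) := by gcongr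
    _ = _ := by
      rw [Real.div_rpow hst'.le hT'.le, holderConst]; ring

lemma holderNorm_le_of_dyadic {γ : ℝ} (hγ : 0 < γ) (hB : 0 ≤ B) (hT : 0 < T)
    (hf : Continuous f) (hf0 : f 0 = 0) (h : ∀ l j, j < 2 ^ l →
      |f (dyadic T l (j + 1)) - f (dyadic T l j)| ≤ B * ((2 : ℝ) ^ (-γ)) ^ l) :
    holderNorm γ T f ≤ ENNReal.ofReal (holderConst γ T * ((T : ℝ) ^ γ + 1) * B) := by
  have hT' : (0 : ℝ) < T := hT
  have hC := holderConst_pos hγ hT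
  have e : holderConst γ T * ((T : ℝ) ^ γ + 1) * B =
      holderConst γ T * B * (T : ℝ) ^ γ + holderConst γ T * B := by ring
  rw [e, ENNReal.ofReal_add (by positivity) (by positivity)]
  refine add_le_add (iSup₂_le fun t ht => ENNReal.ofReal_le_ofReal ?_) ?_
  · rcases eq_or_ne t 0 with rfl | ht0
    · rw [hf0, abs_zero]; positivity
    · have h1 := abs_sub_le_holderConst_mul hγ hB hT hf h (pos_iff_ne_zero.2 ht0) ht
      rw [hf0, sub_zero, NNReal.coe_zero, sub_zero] at h1
      refine h1.trans ?_
      gcongr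
  · refine iSup₂_le fun s t => iSup₂_le fun hst ht => ENNReal.ofReal_le_ofReal ?_
    have hst' : (0 : ℝ) < t - s := sub_pos.2 hst
    rw [div_le_iff₀ (by positivity)]
    exact abs_sub_le_holderConst_mul hγ hB hT hf h hst ht

/-- The dyadic `p`-variation functional which controls the `C^γ` norm. -/
def dyadicSum (γ p : ℝ) (T : ℝ≥0) (f : ℝ≥0 → ℝ) : ℝ≥0∞ :=
  ∑' l : ℕ, ∑ j ∈ Finset.range (2 ^ l),
    (ENNReal.ofReal (((2 : ℝ) ^ γ) ^ l) * ‖f (dyadic T l (j + 1)) - f (dyadic T l j)‖ₑ) ^ p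

/-- Every weighted dyadic increment is a term of a nonnegative sum, so `B = dyadicSum^(1/p)` is
admissible in `holderNorm_le_of_dyadic`. -/
lemma holderNorm_rpow_le {γ p : ℝ} (hγ : 0 < γ) (hp : 0 < p) (hT : 0 < T)
    (hf : Continuous f) (hf0 : f 0 = 0) :
    holderNorm γ T f ^ p ≤
      ENNReal.ofReal (holderConst γ T * ((T : ℝ) ^ γ + 1)) ^ p * dyadicSum γ p T f := by
  have hC := holderConst_pos hγ hT
  have hC' : 0 < holderConst γ T * ((T : ℝ) ^ γ + 1) := by positivity
  rcases eq_or_ne (dyadicSum γ p T f) ∞ with htop | htop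
  · rw [htop, ENNReal.mul_top]
    · exact le_top
    · exact (ENNReal.rpow_pos (ENNReal.ofReal_pos.2 hC') ENNReal.ofReal_ne_top).ne'
  have hpow : dyadicSum γ p T f ^ p⁻¹ ≠ ∞ := ENNReal.rpow_ne_top_of_nonneg (by positivity) htop
  have key : holderNorm γ T f ≤ ENNReal.ofReal (holderConst γ T * ((T : ℝ) ^ γ + 1)) *
      dyadicSum γ p T f ^ p⁻¹ := by
    conv_rhs => rw [← ENNReal.ofReal_toReal hpow, ← ENNReal.ofReal_mul hC'.le]
    refine holderNorm_le_of_dyadic hγ ENNReal.toReal_nonneg hT hf hf0 fun l j hj => ?_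
    have h1 : (ENNReal.ofReal (((2 : ℝ) ^ γ) ^ l) *
        ‖f (dyadic T l (j + 1)) - f (dyadic T l j)‖ₑ) ^ p ≤ dyadicSum γ p T f :=
      (Finset.single_le_sum (f := fun j => (ENNReal.ofReal (((2 : ℝ) ^ γ) ^ l) *
        ‖f (dyadic T l (j + 1)) - f (dyadic T l j)‖ₑ) ^ p) (fun _ _ => zero_le)
        (Finset.mem_range.2 hj)).trans (ENNReal.le_tsum l)
    have h2 := ENNReal.toReal_mono hpow ((ENNReal.le_rpow_inv_iff hp).2 h1)
    rw [ENNReal.toReal_mul, ENNReal.toReal_ofReal (by positivity), toReal_enorm,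
      Real.norm_eq_abs] at h2
    have h3 : ((2 : ℝ) ^ (-γ)) ^ l = (((2 : ℝ) ^ γ) ^ l)⁻¹ := by
      rw [Real.rpow_neg (by norm_num), inv_pow]
    rw [h3, ← div_eq_mul_inv, le_div_iff₀ (by positivity), mul_comm]
    exact h2
  calc holderNorm γ T f ^ p ≤ (ENNReal.ofReal (holderConst γ T * ((T : ℝ) ^ γ + 1)) *
      dyadicSum γ p T f ^ p⁻¹) ^ p := by gcongr
    _ = _ := by rw [ENNReal.mul_rpow_of_nonneg _ _ hp.le, ENNReal.rpow_inv_rpow hp.ne']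

/-! ### Moments of the Hölder norm of a process -/

variable {Ω : Type*} [MeasurableSpace Ω] {P : Measure Ω} {Z : ℝ≥0 → Ω → ℝ}

/-- The constant in the moment bound for `dyadicSum`. -/
def chainingConst (γ β p : ℝ) (T : ℝ≥0) : ℝ≥0∞ :=
  ENNReal.ofReal ((T : ℝ) ^ β) ^ p * (1 - ENNReal.ofReal (2 ^ (1 + (γ - β) * p)))⁻¹

lemma chainingConst_ne_top {γ β p : ℝ} (hp0 : 0 < p) (hp : 1 < (β - γ) * p) :
    chainingConst γ β p T ≠ ∞ := by
  refine ENNReal.mul_ne_top (ENNReal.rpow_ne_top_of_nonneg hp0.le ENNReal.ofReal_ne_top) ?_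
  rw [ENNReal.inv_ne_top]
  refine (tsub_pos_of_lt ?_).ne'
  rw [ENNReal.ofReal_lt_one]
  exact Real.rpow_lt_one_of_one_lt_of_neg one_lt_two (by linarith)

/-- Level `l` has `2^l` increments over intervals of length `T 2^(-l)`, each weighted by `2^(γ l)`;
this makes a geometric series of ratio `2^(1 + (γ-β)p)`. In `ℝ≥0∞` the series may be summed for any
ratio, and `(β-γ)p > 1` matters only for finiteness of `chainingConst`. -/
lemma lintegral_dyadicSum_le {γ β p M : ℝ} (hp0 : 0 < p) (hM : 0 ≤ M)
    (hT : 0 < T) (hZ : ∀ s t : ℝ≥0, s < t → LpBound P (ENNReal.ofReal p)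
      (fun ω => Z t ω - Z s ω) (M * (t - s : ℝ) ^ β)) :
    ∫⁻ ω, dyadicSum γ p T (fun t => Z t ω) ∂P ≤ chainingConst γ β p T * ENNReal.ofReal M ^ p := by
  have hT' : (0 : ℝ) < T := hT
  have hlt : ∀ l j, dyadic T l j < dyadic T l (j + 1) := by
    intro l j
    unfold dyadic
    gcongr
    simp
  have hdist : ∀ l j, (dyadic T l (j + 1) : ℝ) - dyadic T l j = T * (2 ^ l)⁻¹ := by
    intro l j
    rw [coe_dyadic, coe_dyadic]; push_cast; ring
  have hmeas : ∀ l j, AEMeasurable (fun ω => (ENNReal.ofReal (((2 : ℝ) ^ γ) ^ l) *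
      ‖Z (dyadic T l (j + 1)) ω - Z (dyadic T l j) ω‖ₑ) ^ p) P := fun l j =>
    ((hZ _ _ (hlt l j)).1.enorm.const_mul _).pow_const _
  have hterm : ∀ l j, ∫⁻ ω, (ENNReal.ofReal (((2 : ℝ) ^ γ) ^ l) *
      ‖Z (dyadic T l (j + 1)) ω - Z (dyadic T l j) ω‖ₑ) ^ p ∂P ≤
      ENNReal.ofReal (((2 : ℝ) ^ γ) ^ l * (M * (T * (2 ^ l)⁻¹ : ℝ) ^ β)) ^ p := by
    intro l j
    have h1 := hZ _ _ (hlt l j)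
    have h2 : ∫⁻ ω, ‖Z (dyadic T l (j + 1)) ω - Z (dyadic T l j) ω‖ₑ ^ p ∂P ≤
        ENNReal.ofReal (M * (T * (2 ^ l)⁻¹ : ℝ) ^ β) ^ p := by
      have h3 := h1.le
      rw [hdist, eLpNorm_eq_lintegral_rpow_enorm_toReal (by simpa using hp0) (by simp),
        ENNReal.toReal_ofReal hp0.le, one_div, ENNReal.rpow_inv_le_iff hp0] at h3
      exact h3
    simp only [ENNReal.mul_rpow_of_nonneg _ _ hp0.le]
    rw [lintegral_const_mul'' _ (h1.1.enorm.pow_const _), ENNReal.ofReal_mul (by positivity),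
      ENNReal.mul_rpow_of_nonneg _ _ hp0.le]
    gcongr
  unfold dyadicSum
  rw [lintegral_tsum fun l => Finset.aemeasurable_fun_sum _ fun j _ => hmeas l j]
  have hsum : ∀ l : ℕ, ∫⁻ ω, ∑ j ∈ Finset.range (2 ^ l), (ENNReal.ofReal (((2 : ℝ) ^ γ) ^ l) *
      ‖Z (dyadic T l (j + 1)) ω - Z (dyadic T l j) ω‖ₑ) ^ p ∂P ≤
      ENNReal.ofReal ((T : ℝ) ^ β) ^ p * ENNReal.ofReal M ^ p *
        ENNReal.ofReal (2 ^ (1 + (γ - β) * p)) ^ l := by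
    intro l
    rw [lintegral_finsetSum' _ fun j _ => hmeas l j]
    refine (Finset.sum_le_sum fun j _ => hterm l j).trans (le_of_eq ?_)
    rw [Finset.sum_const, Finset.card_range, nsmul_eq_mul, ENNReal.ofReal_rpow_of_nonneg
      (by positivity) hp0.le, ENNReal.ofReal_rpow_of_nonneg (by positivity) hp0.le,
      ENNReal.ofReal_rpow_of_nonneg hM hp0.le, ← ENNReal.ofReal_pow (by positivity),
      ← ENNReal.ofReal_mul (by positivity), ← ENNReal.ofReal_mul (by positivity),
      ← ENNReal.ofReal_natCast, ← ENNReal.ofReal_mul (by positivity)]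
    congr 1
    have e1 : (2 : ℝ) ^ (1 + (γ - β) * p) = 2 * (2 ^ γ * (2 ^ β)⁻¹) ^ p := by
      rw [Real.rpow_add (by norm_num), Real.rpow_one, Real.rpow_mul (by norm_num),
        Real.rpow_sub (by norm_num), div_eq_mul_inv]
    have e2 : (((2 : ℝ) ^ l)⁻¹) ^ β = (((2 : ℝ) ^ β)⁻¹) ^ l := by
      rw [Real.inv_rpow (by positivity), inv_pow, ← Real.rpow_natCast, ← Real.rpow_natCast,
        ← Real.rpow_mul (by norm_num), ← Real.rpow_mul (by norm_num), mul_comm]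
    have e3 : ((2 : ℝ) ^ γ) ^ l * (M * (T * (2 ^ l)⁻¹ : ℝ) ^ β) =
        (T : ℝ) ^ β * M * (2 ^ γ * (2 ^ β)⁻¹) ^ l := by
      rw [Real.mul_rpow hT'.le (by positivity), e2, mul_pow]; ring
    rw [e3, Real.mul_rpow (by positivity) (by positivity),
      Real.mul_rpow (by positivity) hM, e1, mul_pow 2, Real.rpow_pow_comm (by positivity)]
    push_cast
    ring
  refine (ENNReal.tsum_le_tsum hsum).trans (le_of_eq ?_)
  rw [ENNReal.tsum_mul_left, ENNReal.tsum_geometric, chainingConst]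
  ring

lemma lintegral_holderNorm_rpow_le {γ β p M : ℝ} (hγ : 0 < γ) (hp0 : 0 < p) (hM : 0 ≤ M)
    (hT : 0 < T) (hZ : ∀ s t : ℝ≥0, s < t → LpBound P (ENNReal.ofReal p)
      (fun ω => Z t ω - Z s ω) (M * (t - s : ℝ) ^ β))
    (hcont : ∀ᵐ ω ∂P, Continuous fun t => Z t ω) (hZ0 : ∀ᵐ ω ∂P, Z 0 ω = 0) :
    ∫⁻ ω, holderNorm γ T (fun t => Z t ω) ^ p ∂P ≤
      ENNReal.ofReal (holderConst γ T * ((T : ℝ) ^ γ + 1)) ^ p *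
        (chainingConst γ β p T * ENNReal.ofReal M ^ p) := by
  refine (lintegral_mono_ae (g := fun ω =>
    ENNReal.ofReal (holderConst γ T * ((T : ℝ) ^ γ + 1)) ^ p *
      dyadicSum γ p T (fun t => Z t ω)) ?_).trans ?_
  · filter_upwards [hcont, hZ0] with ω h1 h2 using holderNorm_rpow_le hγ hp0 hT h1 h2
  · rw [lintegral_const_mul' _ _ (ENNReal.rpow_ne_top_of_nonneg hp0.le ENNReal.ofReal_ne_top)]
    gcongr
    exact lintegral_dyadicSum_le hp0 hM hT hZ

/-! ### Measurability of the Hölder norm -/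

/-- By continuity the supremum may be taken over a countable dense set of indices. -/
lemma aemeasurable_iSup_of_continuous {ι : Type*} [TopologicalSpace ι]
    [TopologicalSpace.SeparableSpace ι] {F : ι → Ω → ℝ≥0∞} (hF : ∀ i, AEMeasurable (F i) P)
    (hc : ∀ᵐ ω ∂P, Continuous fun i => F i ω) : AEMeasurable (fun ω => ⨆ i, F i ω) P := by
  obtain ⟨D, hD, hDd⟩ := TopologicalSpace.exists_countable_dense ι
  have : Countable D := hD.to_subtype
  refine (AEMeasurable.iSup fun d : D => hF d).congr ?_
  filter_upwards [hc] with ω hω using hDd.ciSup' hω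

lemma aemeasurable_holderNorm {γ : ℝ} (hγ : 0 < γ) (hZ : ∀ t, AEStronglyMeasurable (Z t) P)
    (hcont : ∀ᵐ ω ∂P, Continuous fun t => Z t ω) :
    AEMeasurable (fun ω => holderNorm γ T (fun t => Z t ω)) P := by
  have hZ' : ∀ t, AEMeasurable (Z t) P := fun t => (hZ t).aemeasurable
  refine AEMeasurable.add ?_ ?_
  · have h : ∀ ω, (⨆ (t : ℝ≥0) (_ : t ≤ T), ENNReal.ofReal |Z t ω|) =
        ⨆ a : {t : ℝ≥0 // t ≤ T}, ENNReal.ofReal |Z a ω| := fun ω => iSup_subtype'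
    simp only [h]
    refine aemeasurable_iSup_of_continuous (fun a => ?_) ?_
    · exact (continuous_abs.measurable.comp_aemeasurable (hZ' a)).ennreal_ofReal
    · filter_upwards [hcont] with ω hω
      exact ENNReal.continuous_ofReal.comp (by fun_prop)
  · have h : ∀ ω, (⨆ (s : ℝ≥0) (t : ℝ≥0) (_ : s < t) (_ : t ≤ T),
        ENNReal.ofReal (|Z t ω - Z s ω| / ((t : ℝ) - s) ^ γ)) =
        ⨆ a : {x : ℝ≥0 × ℝ≥0 // x.1 < x.2 ∧ x.2 ≤ T},
          ENNReal.ofReal (|Z a.1.2 ω - Z a.1.1 ω| / ((a.1.2 : ℝ) - a.1.1) ^ γ) := by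
      intro ω
      refine le_antisymm (iSup₂_le fun s t => iSup₂_le fun hst ht => ?_)
        (iSup_le fun a => ?_)
      · exact le_iSup (fun a : {x : ℝ≥0 × ℝ≥0 // x.1 < x.2 ∧ x.2 ≤ T} =>
          ENNReal.ofReal (|Z a.1.2 ω - Z a.1.1 ω| / ((a.1.2 : ℝ) - a.1.1) ^ γ))
          ⟨(s, t), hst, ht⟩
      · exact le_iSup₂_of_le a.1.1 a.1.2 (le_iSup₂_of_le a.2.1 a.2.2 le_rfl)
    simp only [h]
    refine aemeasurable_iSup_of_continuous (fun a => ?_) ?_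
    · exact ((continuous_abs.measurable.comp_aemeasurable
        ((hZ' a.1.2).sub (hZ' a.1.1))).div_const _).ennreal_ofReal
    · filter_upwards [hcont] with ω hω
      refine ENNReal.continuous_ofReal.comp (Continuous.div (by fun_prop) ?_ fun a => ?_)
      · exact Continuous.rpow_const (by fun_prop) fun _ => Or.inr hγ.le
      · have : (0 : ℝ) < a.1.2 - a.1.1 := sub_pos.2 a.2.1
        positivity

end

section

variable {Ω : Type*} [MeasurableSpace Ω]

/-! ### Convergence of the hybrid scheme -/

variable {P : Measure Ω} {W X : ℝ≥0 → Ω → ℝ} {H : ℝ} {T : ℝ≥0} {N : ℕ} {γ : ℝ}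

/-- The `C^γ` norm of the error of the hybrid scheme with `N` steps. -/
def errorNorm (H γ : ℝ) (T : ℝ≥0) (W : ℝ≥0 → Ω → ℝ) (P : Measure Ω) (X : ℝ≥0 → Ω → ℝ) (N : ℕ)
    (ω : Ω) : ℝ≥0∞ :=
  holderNorm γ T fun t => hybrid H T W P N t ω - X t ω

lemma ae_continuous_error (hX : IsRiemannLiouvilleFBM H W P X) (hm : 0 < mesh T N) :
    ∀ᵐ ω ∂P, Continuous fun t => hybrid H T W P N t ω - X t ω := by
  filter_upwards [hX.continuous_paths] with ω h using (continuous_hybrid hm ω).sub h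

lemma aemeasurable_errorNorm (hW : IsPreBrownianReal W P) (hH0 : 0 < H) (hH1 : H < 1)
    (hX : IsRiemannLiouvilleFBM H W P X) (hm : 0 < mesh T N) (hγ : 0 < γ) :
    AEMeasurable (errorNorm H γ T W P X N) P :=
  aemeasurable_holderNorm (Z := fun t ω => hybrid H T W P N t ω - X t ω) hγ
    (fun t => (aestronglyMeasurable_hybrid hW hH0 hH1 t).sub
      (aestronglyMeasurable_process hW hH0 hH1 hX t)) (ae_continuous_error hX hm)

/-- For large `p`, the `p`-th moment of the error in `C^γ` is `O(Δ^(p(H-γ)/2))`. -/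
lemma exists_lintegral_errorNorm_rpow_le (hW : IsPreBrownianReal W P) (hH0 : 0 < H) (hH1 : H < 1)
    (hX : IsRiemannLiouvilleFBM H W P X) (hT : 0 < T) (hγ : 0 < γ) (hγH : γ < H)
    {p : ℝ} (hp1 : 1 ≤ p) (hp : 1 < (H - γ) / 2 * p) :
    ∃ C : ℝ≥0∞, C ≠ ∞ ∧ ∀ N : ℕ, 0 < N → ∫⁻ ω, errorNorm H γ T W P X N ω ^ p ∂P ≤
      C * ENNReal.ofReal ((mesh T N : ℝ) ^ ((H - γ) / 2)) ^ p := by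
  have hp0 : 0 < p := by linarith
  -- The midpoint splits `H - γ` evenly between the rate `H - β` and the chaining gap `β - γ`.
  set β := (H + γ) / 2 with hβ
  have e1 : H - β = (H - γ) / 2 := by rw [hβ]; ring
  have e2 : β - γ = (H - γ) / 2 := by rw [hβ]; ring
  set K := scaleConst H (ENNReal.ofReal p) with hK
  have hK0 : 0 ≤ K := scaleConst_nonneg _ _
  refine ⟨ENNReal.ofReal (holderConst γ T * ((T : ℝ) ^ γ + 1)) ^ p *
    (chainingConst γ β p T * ENNReal.ofReal (10 * K) ^ p), ?_, fun N hN => ?_⟩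
  · refine ENNReal.mul_ne_top (ENNReal.rpow_ne_top_of_nonneg hp0.le ENNReal.ofReal_ne_top)
      (ENNReal.mul_ne_top (chainingConst_ne_top hp0 (by rwa [e2]))
        (ENNReal.rpow_ne_top_of_nonneg hp0.le ENNReal.ofReal_ne_top))
  · have hm := mesh_pos hT hN
    have hm' : (0 : ℝ) < mesh T N := hm
    have h := lintegral_holderNorm_rpow_le (P := P) (β := β) (p := p)
      (Z := fun t ω => hybrid H T W P N t ω - X t ω)
      (M := 10 * K * (mesh T N : ℝ) ^ (H - β)) hγ hp0 (by positivity) hT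
      (fun s t hst => lpBound_error_sub hW hH0 hH1 hX (by
        rw [← ENNReal.ofReal_one]; exact ENNReal.ofReal_le_ofReal hp1) ENNReal.ofReal_ne_top hm
        (by rw [hβ]; linarith) (by rw [hβ]; linarith) hst)
      (ae_continuous_error hX hm) (by
        filter_upwards [ae_process_zero hW hH0 hH1 hX] with ω h
        rw [h, hybrid_zero hm, sub_zero])
    refine h.trans (le_of_eq ?_)
    rw [ENNReal.ofReal_mul (p := 10 * K) (by positivity), ENNReal.mul_rpow_of_nonneg _ _ hp0.le, e1]
    ring

/-- The limit is over all `N`, since moments along an arbitrary sequence of meshes need not be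
summable. Over all `N` they are, so the series of `p`-th powers is almost surely finite and its
terms tend to `0`. -/
lemma ae_tendsto_errorNorm (hW : IsPreBrownianReal W P) (hH0 : 0 < H) (hH1 : H < 1)
    (hX : IsRiemannLiouvilleFBM H W P X) (hT : 0 < T) (hγ : 0 < γ) (hγH : γ < H) :
    ∀ᵐ ω ∂P, Tendsto (fun N => errorNorm H γ T W P X N ω) atTop (𝓝 0) := by
  have hδ : 0 < (H - γ) / 2 := by linarith
  set δ := (H - γ) / 2 with hδdef
  -- This choice turns the moment bound into a constant times `(T/N)^2`.
  set p := 2 / δ with hp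
  have hδp : δ * p = 2 := by rw [hp]; field_simp
  have hp1 : 1 ≤ p := by
    rw [hp, le_div_iff₀ hδ, hδdef]; linarith
  have hp0 : 0 < p := by linarith
  obtain ⟨C, hC, hle⟩ := exists_lintegral_errorNorm_rpow_le hW hH0 hH1 hX hT hγ hγH hp1
    (by rw [← hδdef, hδp]; norm_num)
  have hbound : ∀ N : ℕ, ∫⁻ ω, errorNorm H γ T W P X (N + 1) ω ^ p ∂P ≤
      C * ENNReal.ofReal ((T : ℝ) ^ 2 * (1 / ((N + 1 : ℕ) : ℝ) ^ 2)) := by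
    intro N
    refine (hle (N + 1) N.succ_pos).trans (le_of_eq ?_)
    rw [ENNReal.ofReal_rpow_of_nonneg (by positivity) hp0.le, ← Real.rpow_mul (by positivity), hδp]
    congr 2
    rw [mesh, NNReal.coe_div, NNReal.coe_natCast, Real.rpow_two, div_pow]
    ring
  have hsum : ∑' N : ℕ, C * ENNReal.ofReal ((T : ℝ) ^ 2 * (1 / ((N + 1 : ℕ) : ℝ) ^ 2)) ≠ ∞ := by
    rw [ENNReal.tsum_mul_left]
    refine ENNReal.mul_ne_top hC (Summable.tsum_ofReal_ne_top ?_)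
    exact (((summable_nat_add_iff 1).2 (Real.summable_one_div_nat_pow.2 one_lt_two))).mul_left _
  have hmeas : ∀ N : ℕ, AEMeasurable (fun ω => errorNorm H γ T W P X (N + 1) ω ^ p) P := fun N =>
    (aemeasurable_errorNorm hW hH0 hH1 hX (mesh_pos hT N.succ_pos) hγ).pow_const p
  have hfin : ∫⁻ ω, ∑' N : ℕ, errorNorm H γ T W P X (N + 1) ω ^ p ∂P ≠ ∞ := by
    rw [lintegral_tsum hmeas]
    exact ne_top_of_le_ne_top hsum (ENNReal.tsum_le_tsum hbound)
  filter_upwards [ae_lt_top' (AEMeasurable.tsum hmeas) hfin] with ω hω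
  have h1 := ENNReal.tendsto_atTop_zero_of_tsum_ne_top hω.ne
  have h2 := (ENNReal.continuous_rpow_const (y := p⁻¹)).tendsto 0 |>.comp h1
  rw [ENNReal.zero_rpow_of_pos (inv_pos.2 hp0)] at h2
  -- The sum runs over `N + 1` because the moment bound requires at least one step.
  refine (tendsto_add_atTop_iff_nat 1).1 (h2.congr fun N => ?_)
  exact ENNReal.rpow_rpow_inv hp0.ne' _

lemma exists_eLpNorm_errorNorm_le [IsProbabilityMeasure P] (hW : IsPreBrownianReal W P)
    (hH0 : 0 < H) (hH1 : H < 1) (hX : IsRiemannLiouvilleFBM H W P X) (hT : 0 < T) (hγ : 0 < γ)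
    (hγH : γ < H) (p : ℝ) :
    ∃ C : ℝ≥0∞, C ≠ ∞ ∧ ∀ N : ℕ, 0 < N → eLpNorm (errorNorm H γ T W P X N) (ENNReal.ofReal p) P ≤
      C * ENNReal.ofReal ((mesh T N : ℝ) ^ ((H - γ) / 2)) := by
  have hδ : 0 < (H - γ) / 2 := by linarith
  set δ := (H - γ) / 2 with hδdef
  -- The moment bound needs a large exponent; passing from `p` up to `q` is free under a probability
  -- measure.
  set q := max p (2 / δ) with hq
  have hq2 : 2 / δ ≤ q := le_max_right _ _
  have hδq : 1 < δ * q := by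
    rw [div_le_iff₀ hδ] at hq2
    linarith
  have hq1 : 1 ≤ q := by
    refine le_trans ?_ hq2
    rw [le_div_iff₀ hδ, hδdef]; linarith
  have hq0 : 0 < q := by linarith
  obtain ⟨C, hC, hle⟩ := exists_lintegral_errorNorm_rpow_le hW hH0 hH1 hX hT hγ hγH hq1 hδq
  refine ⟨C ^ q⁻¹, ENNReal.rpow_ne_top_of_nonneg (by positivity) hC, fun N hN => ?_⟩
  refine (eLpNorm_le_eLpNorm_of_exponent_le (q := ENNReal.ofReal q)
    (ENNReal.ofReal_le_ofReal (le_max_left _ _))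
    (aemeasurable_errorNorm hW hH0 hH1 hX (mesh_pos hT hN) hγ).aestronglyMeasurable).trans ?_
  rw [eLpNorm_eq_lintegral_rpow_enorm_toReal (by simpa using hq0) (by simp),
    ENNReal.toReal_ofReal hq0.le, one_div]
  simp only [enorm_eq_self]
  calc _ ≤ (C * ENNReal.ofReal ((mesh T N : ℝ) ^ δ) ^ q) ^ q⁻¹ := by
        gcongr
        exact hle N hN
    _ = _ := by rw [ENNReal.mul_rpow_of_nonneg _ _ (by positivity), ENNReal.rpow_rpow_inv hq0.ne']

/-- Lets the almost sure limit over all `N` be composed with the given sequence. Positivity of `N n`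
excludes the degenerate mesh `T / 0 = 0`. -/
lemma tendsto_atTop_of_tendsto_mesh (hT : 0 < T) {N : ℕ → ℕ} (hN : ∀ n, 0 < N n)
    (hmesh : Tendsto (fun n => mesh T (N n)) atTop (𝓝 0)) : Tendsto N atTop atTop := by
  refine tendsto_atTop.2 fun b => ?_
  have hpos : (0 : ℝ≥0) < T / (b + 1) := by positivity
  filter_upwards [hmesh.eventually_lt_const hpos] with n hn
  have hn' : (0 : ℝ≥0) < N n := by exact_mod_cast hN n
  rw [mesh, div_lt_div_iff_of_pos_left hT hn' (by positivity)] at hn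
  have : b + 1 < N n := by exact_mod_cast hn
  omega

end

end HybridScheme

end

theorem mainTheorem6 {Ω : Type*} [MeasurableSpace Ω] (P : Measure Ω) [IsProbabilityMeasure P]
    (W : ℝ≥0 → Ω → ℝ) (hW : IsBrownianReal W P)
    (H : ℝ) (hH0 : 0 < H) (hH1 : H < 1)
    (X : ℝ≥0 → Ω → ℝ) (hX : HybridScheme.IsRiemannLiouvilleFBM H W P X)
    (T : ℝ≥0) (hT : 0 < T)
    (N : ℕ → ℕ) (hN : ∀ n, 0 < N n)
    (hmesh : Tendsto (fun n => HybridScheme.mesh T (N n)) atTop (𝓝 0))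
    (γ : ℝ) (hγ0 : 0 < γ) (hγH : γ < H) :
    (∀ᵐ ω ∂P, Tendsto (fun n => HybridScheme.holderNorm γ T
        (fun t => HybridScheme.hybrid H T W P (N n) t ω - X t ω)) atTop (𝓝 0)) ∧
    ∀ p : ℝ, 1 ≤ p →
      (∀ n, MemLp (fun ω => HybridScheme.holderNorm γ T
        (fun t => HybridScheme.hybrid H T W P (N n) t ω - X t ω)) (ENNReal.ofReal p) P) ∧
      Tendsto (fun n => eLpNorm (fun ω => HybridScheme.holderNorm γ T
        (fun t => HybridScheme.hybrid H T W P (N n) t ω - X t ω)) (ENNReal.ofReal p) P)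
        atTop (𝓝 0) := by
  have hW' := hW.toIsPreBrownianReal
  refine ⟨?_, fun p hp => ?_⟩
  · filter_upwards [HybridScheme.ae_tendsto_errorNorm hW' hH0 hH1 hX hT hγ0 hγH] with ω hω
    exact hω.comp (HybridScheme.tendsto_atTop_of_tendsto_mesh hT hN hmesh)
  · obtain ⟨C, hC, hle⟩ := HybridScheme.exists_eLpNorm_errorNorm_le hW' hH0 hH1 hX hT hγ0 hγH p
    refine ⟨fun n => ⟨(HybridScheme.aemeasurable_errorNorm hW' hH0 hH1 hX
      (HybridScheme.mesh_pos hT (hN n)) hγ0).aestronglyMeasurable, ?_⟩, ?_⟩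
    · exact (hle (N n) (hN n)).trans_lt (ENNReal.mul_lt_top hC.lt_top ENNReal.ofReal_lt_top)
    · refine tendsto_of_tendsto_of_tendsto_of_le_of_le tendsto_const_nhds ?_
        (fun _ => zero_le) fun n => hle (N n) (hN n)
      have hδ : 0 < (H - γ) / 2 := by linarith
      have h1 : Tendsto (fun n => ((HybridScheme.mesh T (N n) : ℝ≥0) : ℝ) ^ ((H - γ) / 2)) atTop (𝓝 0) := by
        have h2 := (NNReal.tendsto_coe.2 hmesh).rpow_const (p := (H - γ) / 2) (Or.inr hδ.le)
        rwa [NNReal.coe_zero, Real.zero_rpow hδ.ne'] at h2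
      have h3 := ENNReal.Tendsto.const_mul (a := C) (ENNReal.tendsto_ofReal h1) (Or.inr hC)
      rwa [ENNReal.ofReal_zero, mul_zero] at h3
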